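/- Let $\mathcal K$ and $\mathcal H$ be complex Hilbert spaces, each with a complex conjugation $\mathcal C$ (an antiunitary operator with $\mathcal C^2=\mathbf 1$). For a bounded operator $A$ write $\overline A=\mathcal C A\mathcal C$ and $A^t=(\overline A)^*$. Let $I_{\mathcal K}$, $I_{\mathcal H}$ be real unitaries on $\mathcal K$, $\mathcal H$ (that is, $\overline I=I$) with $I_{\mathcal K}^2=-\mathbf 1$, $I_{\mathcal H}^2=-\mathbf 1$. An operator $A$ is odd symmetric if $I^*A^tI=A$. Let $\Pi:\mathcal K\to\mathcal H$ be an isometry which is real ($\mathcal C_{\mathcal H}\Pi=\Pi\,\mathcal C_{\mathcal K}$) and satisfies $I_{\mathcal K}=\Pi^*I_{\mathcal H}\Pi$; assume that $\mathcal K$ and $(\Pi\mathcal K)^\perp\subset\mathcal H$ are infinite dimensional. Let $T$ be an odd symmetric contraction on $\mathcal K$ which is essentially unitary ($T^*T-\mathbf 1$ and $TT^*-\mathbf 1$ are compact), and let $U_T$ be an odd symmetric unitary on $\mathcal H$ which dilates $T$, i.e. $T=\Pi^*U_T\Pi$. Set $F=2\Pi\Pi^*-\mathbf 1$. Spectral flow.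 Let $\mathbb{SF}_*$ be the set of self-adjoint Fredholm operators on $\mathcal H$ having both positive and negative essential spectrum, and $\widehat{\mathbb{SF}}_*$ the set of $G\in\mathbb{SF}_*$ with $\|G\|=1$ and $\sigma_{\rm ess}(G)=\{-1,1\}$. For a norm-continuous path $s\in[\alpha,\beta]\mapsto F_s\in\mathbb{SF}_*$, choose $\alpha=s_0<\dots<s_N=\beta$ and $a_n\in(-1,0)$, $b_n\in(0,1)$ such that on $[s_{n-1},s_n]$ the spectral projection $\chi_{(a_n,b_n]}(F_s)$ is norm continuous of constant finite rank; then $$\mathrm{SF}(s\in[\alpha,\beta]\mapsto F_s)=\sum_{n=1}^N\mathrm{Tr}\bigl(\chi_{(a_n,0]}(F_{s_{n-1}})-\chi_{(a_n,0]}(F_{s_n})\bigr).$$ Here and below, that a spectral flow "is well defined" means that such choices exist and that the sum does not depend on them. $\mathbb Z_2$ spectral flow. Let $\Theta(F,U_T,I_{\mathcal H})$ be the set of norm-continuous paths $s\in[0,1]\mapsto F_s\in\widehat{\mathbb{SF}}_*$ with $F_0=F$, $F_s-F$ compact and $F_{1-s}=(I_{\mathcal H}U_T)^*(F_s)^t(I_{\mathcal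 H}U_T)$ for all $s\in[0,1]$. The number $\mathrm{SF}_2(F,U_T)\in\mathbb Z_2$ is the common value of $\mathrm{SF}(s\in[0,\tfrac12]\mapsto F_s)\bmod 2$ over all paths in $\Theta(F,U_T,I_{\mathcal H})$. Theorem. $T$ is Fredholm, $F$ is odd symmetric and lies in $\widehat{\mathbb{SF}}_*$, the path $s\in[0,1]\mapsto F+s\,U_T^*[F,U_T]$ belongs to $\Theta(F,U_T,I_{\mathcal H})$, $\mathrm{SF}_2(F,U_T)$ is well defined (for every path in $\Theta(F,U_T,I_{\mathcal H})$ the spectral flow of its half $s\in[0,\tfrac12]$ is well defined, and its value modulo $2$ is the same for all these paths), and $$\mathrm{Ind}_2(T):=\dim\mathrm{Ker}(T)\bmod 2\;=\;\mathrm{SF}_2(F,U_T)\;=\;\mathrm{SF}\bigl(s\in[0,\tfrac12]\mapsto F+s\,U_T^*[F,U_T]\bigr)\bmod 2 .$$ -/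

import Mathlib

noncomputable section

namespace OddFlow

open ContinuousLinearMap Set

/-- A complex conjugation (real structure): an antiunitary involution. -/
structure Conjugation (H : Type*) [NormedAddCommGroup H] [InnerProductSpace ℂ H] where
  toEquiv : H ≃ₗᵢ⋆[ℂ] H
  involutive : ∀ x, toEquiv (toEquiv x) = x

section Operators

variable {H : Type*} [NormedAddCommGroup H] [InnerProductSpace ℂ H]

/-- The complex conjugate `C T C` of a bounded operator `T`. -/
def conjOp (C : Conjugation H) (T : H →L[ℂ] H) : H →L[ℂ] H :=
  (C.toEquiv.toContinuousLinearEquiv : H →SL[starRingEnd ℂ] H).comp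
    (T.comp (C.toEquiv.toContinuousLinearEquiv : H →SL[starRingEnd ℂ] H))

/-- The essential spectrum: all `z` for which `F - z` is not Fredholm. -/
def essSpectrum (F : H →L[ℂ] H) : Set ℂ :=
  {z | ¬ IsFredholm (F - z • (1 : H →L[ℂ] H))}

variable [CompleteSpace H]

/-- The transpose, i.e. the adjoint of the complex conjugate. -/
def transposeOp (C : Conjugation H) (T : H →L[ℂ] H) : H →L[ℂ] H :=
  adjoint (conjOp C T)

/-- `I` is a real unitary ("orthogonal") operator with `I² = -1`. -/
structure IsOddStructure (C : Conjugation H) (I : H →L[ℂ] H) : Prop where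
  unitary : I ∈ unitary (H →L[ℂ] H)
  real : conjOp C I = I
  sq : I ∘L I = -1

/-- `T` is odd symmetric: `I* Tᵗ I = T`. -/
def IsOddSymmetric (C : Conjugation H) (I T : H →L[ℂ] H) : Prop :=
  adjoint I ∘L transposeOp C T ∘L I = T

/-- `T` is essentially unitary. -/
structure IsEssentiallyUnitary (T : H →L[ℂ] H) : Prop where
  compact_left : IsCompactOperator (adjoint T ∘L T - 1 : H →L[ℂ] H)
  compact_right : IsCompactOperator (T ∘L adjoint T - 1 : H →L[ℂ] H)

/-- The `ℤ₂`-index `dim Ker T mod 2` (meaningful when `Ker T` is finite dimensional). -/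
def index2 (T : H →L[ℂ] H) : ZMod 2 := (Module.finrank ℂ T.ker : ZMod 2)

/-- Self-adjoint Fredholm operators having both positive and negative essential spectrum. -/
structure IsSFStar (F : H →L[ℂ] H) : Prop where
  selfAdjoint : IsSelfAdjoint F
  fredholm : IsFredholm F
  pos : ∃ x : ℝ, 0 < x ∧ (x : ℂ) ∈ essSpectrum F
  neg : ∃ x : ℝ, x < 0 ∧ (x : ℂ) ∈ essSpectrum F

/-- Those of norm one whose essential spectrum is exactly `{-1, 1}`. -/
structure IsSFStarHat (F : H →L[ℂ] H) : Prop extends IsSFStar F where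
  norm_eq : ‖F‖ = 1
  ess_eq : essSpectrum F = {-1, 1}

/-- The spectral projection `χ_{(-∞, c]}(F)` of a bounded self-adjoint operator `F`: the orthogonal
projection onto the kernel of the positive part `(F - c)₊`. -/
def specProjIic (F : H →L[ℂ] H) (c : ℝ) : H →L[ℂ] H :=
  (cfc (fun x : ℝ => max (x - c) 0) F).ker.starProjection

/-- The spectral projection `χ_{(a, b]}(F)` of a bounded self-adjoint operator `F` (for `a ≤ b`). -/
def specProj (F : H →L[ℂ] H) (a b : ℝ) : H →L[ℂ] H :=
  specProjIic F b - specProjIic F a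

/-- A partition `α = s 0 < s 1 < ⋯ < s N = β` with levels `a n < 0 < b n` attached to the
interval `[s n, s (n+1)]`, on which `χ_{(a n, b n]}(γ t)` is norm continuous and has constant
finite rank. -/
structure IsFlowPartition (γ : ℝ → (H →L[ℂ] H)) (α β : ℝ) (N : ℕ) (s a b : ℕ → ℝ) : Prop where
  left : s 0 = α
  right : s N = β
  lt : ∀ n < N, s n < s (n + 1)
  lower : ∀ n < N, a n ∈ Ioo (-1 : ℝ) 0
  upper : ∀ n < N, b n ∈ Ioo (0 : ℝ) 1
  cont : ∀ n < N, ContinuousOn (fun t => specProj (γ t) (a n) (b n)) (Icc (s n) (s (n + 1)))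
  finite : ∀ n < N, ∀ t ∈ Icc (s n) (s (n + 1)),
    FiniteDimensional ℂ (specProj (γ t) (a n) (b n)).range
  rank : ∀ n < N, ∀ t ∈ Icc (s n) (s (n + 1)), ∀ t' ∈ Icc (s n) (s (n + 1)),
    Module.finrank ℂ (specProj (γ t) (a n) (b n)).range =
      Module.finrank ℂ (specProj (γ t') (a n) (b n)).range

/-- The sum `∑ₙ Tr(χ_{(aₙ,0]}(γ(sₙ)) - χ_{(aₙ,0]}(γ(sₙ₊₁)))`, the trace of a finite rank orthogonal
projection being the dimension of its range. -/
def flowSum (γ : ℝ → (H →L[ℂ] H)) (N : ℕ) (s a : ℕ → ℝ) : ℤ :=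
  ∑ n ∈ Finset.range N,
    ((Module.finrank ℂ (specProj (γ (s n)) (a n) 0).range : ℤ) -
      (Module.finrank ℂ (specProj (γ (s (n + 1))) (a n) 0).range : ℤ))

/-- The norm-continuous path `t ∈ [α, β] ↦ γ t` of self-adjoint Fredholm operators has (Phillips)
spectral flow `m`: flow partitions exist, and each of them yields the value `m`. -/
structure HasSpectralFlow (γ : ℝ → (H →L[ℂ] H)) (α β : ℝ) (m : ℤ) : Prop where
  cont : ContinuousOn γ (Icc α β)
  mem : ∀ t ∈ Icc α β, IsSFStar (γ t)
  exists_partition : ∃ N s a b, IsFlowPartition γ α β N s a b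
  eq_of_partition : ∀ N s a b, IsFlowPartition γ α β N s a b → flowSum γ N s a = m

/-- The spectral flow of the half-path `t ∈ [0, 1/2] ↦ γ t` is well defined and equals `c`
modulo 2. -/
def HasHalfFlowMod2 (γ : ℝ → (H →L[ℂ] H)) (c : ZMod 2) : Prop :=
  ∃ m : ℤ, HasSpectralFlow γ 0 (1 / 2) m ∧ (m : ZMod 2) = c

/-- The set `Θ(F, U, I)` of paths of compact perturbations of `F` with the reflection symmetry
`F_{1-s} = (I U)* (F_s)ᵗ (I U)`. -/
structure IsThetaPath (C : Conjugation H) (I F U : H →L[ℂ] H) (γ : ℝ → (H →L[ℂ] H)) : Prop where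
  cont : ContinuousOn γ (Icc 0 1)
  mem : ∀ s ∈ Icc (0 : ℝ) 1, IsSFStarHat (γ s)
  start : γ 0 = F
  compact : ∀ s ∈ Icc (0 : ℝ) 1, IsCompactOperator (γ s - F)
  symm : ∀ s ∈ Icc (0 : ℝ) 1,
    γ (1 - s) = adjoint (I ∘L U) ∘L transposeOp C (γ s) ∘L (I ∘L U)

/-- `SF₂(F, U)` is well defined and equals `c`: `Θ(F, U, I)` is nonempty and every path in it
has half-path spectral flow `c` modulo 2. -/
def HasZ2SpectralFlow (C : Conjugation H) (I F U : H →L[ℂ] H) (c : ZMod 2) : Prop :=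
  (∃ γ, IsThetaPath C I F U γ) ∧ ∀ γ, IsThetaPath C I F U γ → HasHalfFlowMod2 γ c

/-- The path `s ↦ F + s U*[F, U]`. -/
def linePath (F U : H →L[ℂ] H) (s : ℝ) : H →L[ℂ] H :=
  F + (s : ℂ) • (adjoint U ∘L (F ∘L U - U ∘L F))

end Operators

/-- `F = 2 Π Π* - 1` for an isometric embedding `Π = V`. -/
def dilationF {K H : Type*} [NormedAddCommGroup K] [InnerProductSpace ℂ K] [CompleteSpace K]
    [NormedAddCommGroup H] [InnerProductSpace ℂ H] [CompleteSpace H]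
    (V : K →ₗᵢ[ℂ] H) : H →L[ℂ] H :=
  (2 : ℂ) • (V.toContinuousLinearMap ∘L adjoint V.toContinuousLinearMap) - 1

end OddFlow

end

/-! The essential spectrum is fixed along a path of compact perturbations of a symmetry `F` (`F² =
1`), so spectral flow depends only on the endpoints. Every spectral projection `χ_{(-∞,a]}` with `a
∈ (-1,1)` differs from `(1 - F)/2` by a compact operator, and for projections with compact
differences the integer `dim (M ∩ Nᗮ) - dim (N ∩ Mᗮ)` is a Fredholm index: additive, and zero for
projections at norm distance less than one. Hence `relIndex` is constant along norm-continuous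
families, each summand of the flow is a relative index, the sum telescopes, and the flow equals the
relative index of the nonpositive spectral subspaces at the two ends (`hasSpectralFlow_relIndex`).

At `s = 1/2` the reflection symmetry of a path in `Θ` says that `F_{1/2}` commutes with the
antiunitary `W = C I U`. Odd symmetry of `U` gives `W² = -1`, so finite dimensional `W`-invariant
subspaces have even dimension (Kramers degeneracy). Two paths in `Θ` start at the same `F` and end
their first halves at `W`-invariant spectral subspaces; by additivity their half flows differ by an
even relative index (`even_relIndex`). One path therefore decides the parity.

For the straight line the midpoint is `G = (F + U*FU)/2`. Comparing quadratic forms, no nonzero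
vector with `Fx = -x` is orthogonal to the nonpositive subspace of `G`, while the vectors of that
subspace with `Fx = x` are exactly `Π (Ker T)`. The half flow is `-dim Ker T` (`relIndex_linePath`),
and the sign is invisible modulo 2. -/

noncomputable section

namespace OddFlow

open ContinuousLinearMap Set Module

/-! ### Algebraic index of linear maps -/

section Algebra

variable {k X Y Z : Type*} [Field k] [AddCommGroup X] [Module k X] [AddCommGroup Y] [Module k Y]
  [AddCommGroup Z] [Module k Z]

/-- The kernel and the cokernel of `f` are finite dimensional. -/
def FiniteKerCoker (f : X →ₗ[k] Y) : Prop :=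
  FiniteDimensional k f.ker ∧ FiniteDimensional k (Y ⧸ f.range)

/-- The index `dim ker f - dim coker f`. -/
def linIndex (f : X →ₗ[k] Y) : ℤ := (finrank k f.ker : ℤ) - (finrank k (Y ⧸ f.range) : ℤ)

/-- The maps `m1`, …, `m4` form the exact sequence `0 → ker f → ker gf → ker g → coker f → coker gf
→ coker g → 0`. Finiteness of the terms in `gf` comes from their neighbours, and the alternating sum
of dimensions gives the index formula. -/
theorem finiteKerCoker_comp_and_index {f : X →ₗ[k] Y} {g : Y →ₗ[k] Z} (hf : FiniteKerCoker f)
    (hg : FiniteKerCoker g) :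
    FiniteKerCoker (g ∘ₗ f) ∧ linIndex (g ∘ₗ f) = linIndex g + linIndex f := by
  obtain ⟨hf1, hf2⟩ := hf
  obtain ⟨hg1, hg2⟩ := hg
  let m1 : (g ∘ₗ f).ker →ₗ[k] g.ker := f.restrict (fun x hx => by simpa using hx)
  let m2 : g.ker →ₗ[k] Y ⧸ f.range := f.range.mkQ ∘ₗ g.ker.subtype
  let m3 : (Y ⧸ f.range) →ₗ[k] Z ⧸ (g ∘ₗ f).range :=
    f.range.mapQ (g ∘ₗ f).range g (by rintro _ ⟨x, rfl⟩; exact ⟨x, rfl⟩)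
  let m4 : (Z ⧸ (g ∘ₗ f).range) →ₗ[k] Z ⧸ g.range :=
    (g ∘ₗ f).range.mapQ g.range LinearMap.id (by rintro _ ⟨x, rfl⟩; exact ⟨f x, rfl⟩)
  have e1 : m1.ker ≃ₗ[k] f.ker :=
    { toFun := fun x => ⟨x.1.1, by
        have := congrArg Subtype.val (LinearMap.mem_ker.1 x.2); exact this⟩
      map_add' := fun _ _ => rfl
      map_smul' := fun _ _ => rfl
      invFun := fun x => ⟨⟨x.1, by
        have : f x.1 = 0 := x.2
        simp [this]⟩, by
        have : f x.1 = 0 := x.2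
        exact LinearMap.mem_ker.2 (Subtype.ext this)⟩
      left_inv := fun _ => rfl
      right_inv := fun _ => rfl }
  have e2 : m2.ker = m1.range := by
    ext ⟨y, hy⟩
    simp only [m2, LinearMap.mem_ker, LinearMap.comp_apply, Submodule.subtype_apply,
      Submodule.mkQ_apply, Submodule.Quotient.mk_eq_zero, LinearMap.mem_range]
    constructor
    · rintro ⟨x, rfl⟩
      exact ⟨⟨x, by simpa using hy⟩, rfl⟩
    · rintro ⟨x, hx⟩
      exact ⟨x, congrArg Subtype.val hx⟩
  have e3 : m3.ker = m2.range := by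
    ext y
    obtain ⟨y, rfl⟩ := f.range.mkQ_surjective y
    simp only [m3, LinearMap.mem_ker, Submodule.mkQ_apply, Submodule.mapQ_apply,
      Submodule.Quotient.mk_eq_zero, LinearMap.mem_range]
    constructor
    · rintro ⟨x, hx⟩
      refine ⟨⟨y - f x, by simpa [sub_eq_zero] using hx.symm⟩, ?_⟩
      simp only [m2, LinearMap.comp_apply, Submodule.subtype_apply, Submodule.mkQ_apply]
      rw [Submodule.Quotient.eq]
      exact ⟨-x, by simp⟩
    · rintro ⟨⟨z, hz⟩, h⟩
      simp only [m2, LinearMap.comp_apply, Submodule.subtype_apply, Submodule.mkQ_apply] at h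
      rw [Submodule.Quotient.eq] at h
      obtain ⟨x, hx⟩ := h
      refine ⟨-x, ?_⟩
      have hz' : g z = 0 := hz
      simp [hx, hz']
  have e4 : m4.ker = m3.range := by
    ext z
    obtain ⟨z, rfl⟩ := (g ∘ₗ f).range.mkQ_surjective z
    simp only [m4, LinearMap.mem_ker, Submodule.mkQ_apply, Submodule.mapQ_apply,
      Submodule.Quotient.mk_eq_zero, LinearMap.mem_range, LinearMap.id_apply]
    constructor
    · rintro ⟨y, rfl⟩
      exact ⟨f.range.mkQ y, rfl⟩
    · rintro ⟨y, hy⟩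
      obtain ⟨y, rfl⟩ := f.range.mkQ_surjective y
      simp only [m3, Submodule.mkQ_apply, Submodule.mapQ_apply] at hy
      rw [Submodule.Quotient.eq] at hy
      obtain ⟨x, hx⟩ := hy
      exact ⟨y - f x, by rw [map_sub, sub_eq_iff_eq_add, ← sub_eq_iff_eq_add', ← hx]; rfl⟩
  have e5 : m4.range = ⊤ := by
    rw [LinearMap.range_eq_top]
    intro z
    obtain ⟨z, rfl⟩ := g.range.mkQ_surjective z
    exact ⟨(g ∘ₗ f).range.mkQ z, rfl⟩
  have i1 : FiniteDimensional k m1.ker := Module.Finite.equiv e1.symm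
  have fd1 : FiniteDimensional k (g ∘ₗ f).ker :=
    have : FiniteDimensional k ((g ∘ₗ f).ker ⧸ m1.ker) :=
      Module.Finite.equiv m1.quotKerEquivRange.symm
    Module.Finite.of_submodule_quotient m1.ker
  have fd2 : FiniteDimensional k (Z ⧸ (g ∘ₗ f).range) :=
    have : FiniteDimensional k (m4.ker) := by rw [e4]; infer_instance
    have : FiniteDimensional k ((Z ⧸ (g ∘ₗ f).range) ⧸ m4.ker) :=
      Module.Finite.equiv m4.quotKerEquivRange.symm
    Module.Finite.of_submodule_quotient m4.ker
  refine ⟨⟨fd1, fd2⟩, ?_⟩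
  have r1 := m1.finrank_range_add_finrank_ker
  have r2 := m2.finrank_range_add_finrank_ker
  have r3 := m3.finrank_range_add_finrank_ker
  have r4 := m4.finrank_range_add_finrank_ker
  rw [e1.finrank_eq] at r1
  rw [e2] at r2
  rw [e3] at r3
  rw [e4, e5, finrank_top] at r4
  simp only [linIndex]
  omega

theorem linIndex_of_bijective {f : X →ₗ[k] Y} (hf : Function.Bijective f) :
    FiniteKerCoker f ∧ linIndex f = 0 := by
  have h1 : f.ker = ⊥ := LinearMap.ker_eq_bot.2 hf.1
  have h2 : f.range = ⊤ := LinearMap.range_eq_top.2 hf.2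
  have : Subsingleton (Y ⧸ f.range) := by
    rw [h2]; infer_instance
  refine ⟨⟨by rw [h1]; infer_instance, inferInstance⟩, ?_⟩
  rw [linIndex, h1, finrank_bot, finrank_zero_of_subsingleton, sub_self]

/-- A finite rank perturbation of the identity has index zero. -/
theorem linIndex_id_add {r : X →ₗ[k] X} (hr : r.HasFiniteRange) :
    FiniteKerCoker (LinearMap.id + r) ∧ linIndex (LinearMap.id + r) = 0 := by
  have hfr : FiniteDimensional k r.range := Module.Finite.of_fg hr
  have hq : FiniteDimensional k (X ⧸ r.ker) := Module.Finite.equiv r.quotKerEquivRange.symm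
  have hle : (LinearMap.id + r).ker ≤ r.range := by
    intro x hx
    have : x + r x = 0 := hx
    exact ⟨-x, by rw [map_neg, neg_eq_iff_add_eq_zero, add_comm]; exact this⟩
  have hle' : r.ker ≤ (LinearMap.id + r).range := by
    intro x hx
    have : r x = 0 := hx
    exact ⟨x, by simp [this]⟩
  have h1 : FiniteKerCoker (LinearMap.id + r) :=
    ⟨Submodule.finiteDimensional_of_le hle,
      Module.Finite.of_surjective (Submodule.factor hle') (Submodule.factor_surjective hle')⟩
  refine ⟨h1, ?_⟩
  -- The inclusion of `ker r` has finite codimension, and `1 + r` leaves it unchanged under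
  -- composition; additivity then forces the index of `1 + r` to vanish.
  have hi : FiniteKerCoker r.ker.subtype := by
    refine ⟨by rw [Submodule.ker_subtype]; infer_instance, ?_⟩
    rw [Submodule.range_subtype]; exact hq
  have heq : (LinearMap.id + r) ∘ₗ r.ker.subtype = r.ker.subtype := by
    ext x
    have : r x = 0 := x.2
    simp [this]
  have := (finiteKerCoker_comp_and_index hi h1).2
  rw [heq] at this
  omega

end Algebra

/-! ### Fredholm operators modulo compact operators -/

section Compact

section Wrappers

variable {X Y Z : Type*} [NormedAddCommGroup X] [NormedSpace ℂ X]
  [NormedAddCommGroup Y] [NormedSpace ℂ Y] [NormedAddCommGroup Z] [NormedSpace ℂ Z]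

theorem isCompactOperator_add {A B : X →L[ℂ] Y} (hA : IsCompactOperator A)
    (hB : IsCompactOperator B) : IsCompactOperator (A + B : X →L[ℂ] Y) :=
  hA.add hB

theorem isCompactOperator_neg {A : X →L[ℂ] Y} (hA : IsCompactOperator A) :
    IsCompactOperator (-A : X →L[ℂ] Y) :=
  hA.neg

theorem isCompactOperator_smul {A : X →L[ℂ] Y} (hA : IsCompactOperator A) (c : ℂ) :
    IsCompactOperator (c • A : X →L[ℂ] Y) :=
  hA.smul c

theorem isCompactOperator_sub_comm {A B : X →L[ℂ] Y}
    (h : IsCompactOperator (A - B : X →L[ℂ] Y)) : IsCompactOperator (B - A : X →L[ℂ] Y) := by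
  have := isCompactOperator_neg h
  rwa [neg_sub] at this

theorem isCompactOperator_sub_trans {A B C : X →L[ℂ] Y}
    (h : IsCompactOperator (A - B : X →L[ℂ] Y)) (h' : IsCompactOperator (B - C : X →L[ℂ] Y)) :
    IsCompactOperator (A - C : X →L[ℂ] Y) := by
  have := isCompactOperator_add h h'
  rwa [sub_add_sub_cancel] at this

theorem isCompactOperator_comp_left {A : X →L[ℂ] Y} (hA : IsCompactOperator A) (B : Y →L[ℂ] Z) :
    IsCompactOperator (B ∘L A : X →L[ℂ] Z) :=
  hA.clm_comp B

theorem isCompactOperator_comp_right {A : Y →L[ℂ] Z} (hA : IsCompactOperator A)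
    (B : X →L[ℂ] Y) : IsCompactOperator (A ∘L B : X →L[ℂ] Z) :=
  hA.comp_clm B

end Wrappers

variable {X Y : Type*} [NormedAddCommGroup X] [InnerProductSpace ℂ X]
  [NormedAddCommGroup Y] [InnerProductSpace ℂ Y]

theorem finiteKerCoker_of_isFredholm {T : X →L[ℂ] Y} (hT : IsFredholm T) :
    FiniteKerCoker (T : X →ₗ[ℂ] Y) :=
  ⟨hT.finite_ker, hT.finite_coker⟩

/-- Compact operators into a Hilbert space are norm limits of finite rank operators. -/
theorem exists_finiteRange_norm_sub_le (A : X →L[ℂ] Y) (hA : IsCompactOperator A) {ε : ℝ}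
    (hε : 0 < ε) : ∃ R : X →L[ℂ] Y, (R : X →ₗ[ℂ] Y).HasFiniteRange ∧ ‖A - R‖ ≤ ε := by
  obtain ⟨S, hS, hAS⟩ := hA.image_closedBall_subset_compact 1
  obtain ⟨t, ht, hcov⟩ := Metric.totallyBounded_iff.1 hS.totallyBounded ε hε
  -- Projecting onto the span of a finite `ε`-net of the image of the unit ball moves each image
  -- point by at most its distance to the net.
  let E := Submodule.span ℂ t
  have : FiniteDimensional ℂ E := FiniteDimensional.span_of_finite ℂ ht
  refine ⟨E.starProjection ∘L A, ?_, ?_⟩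
  · have : (E.starProjection : Y →ₗ[ℂ] Y).HasFiniteRange := by
      rw [LinearMap.HasFiniteRange, Submodule.range_starProjection]
      exact (Submodule.fg_iff_finiteDimensional E).2 this
    exact this.comp_right (A : X →ₗ[ℂ] Y)
  · refine ContinuousLinearMap.opNorm_le_of_unit_norm hε.le fun x hx => ?_
    obtain ⟨y, hy, hxy⟩ := mem_iUnion₂.1 (hcov (hAS ⟨x, by simp [hx], rfl⟩))
    have hyE : y ∈ E := Submodule.subset_span hy
    rw [sub_apply, comp_apply, Submodule.starProjection_minimal]
    refine (ciInf_le ⟨0, ?_⟩ (⟨y, hyE⟩ : E)).trans ?_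
    · rintro _ ⟨z, rfl⟩; exact norm_nonneg _
    · rw [← dist_eq_norm]; exact (Metric.mem_ball.1 hxy).le

variable [CompleteSpace X] [CompleteSpace Y]

open scoped LinearMap.FiniteRangeSetoid

/-- A compact perturbation of the identity is Fredholm of index zero. -/
theorem isFredholm_of_sub_one_compact (T : X →L[ℂ] X)
    (hT : IsCompactOperator (T - 1 : X →L[ℂ] X)) :
    IsFredholm T ∧ linIndex (T : X →ₗ[ℂ] X) = 0 := by
  obtain ⟨R, hR, hn⟩ := exists_finiteRange_norm_sub_le (T - 1) hT (ε := 1 / 2) (by norm_num)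
  have hu : IsUnit (T - R) := by
    have := isUnit_one_sub_of_norm_lt_one (x := -(T - 1 - R)) (by rw [norm_neg]; linarith)
    convert this using 1
    abel
  obtain ⟨u, hu⟩ := hu
  have h1 : ∀ x, (↑u⁻¹ : X →L[ℂ] X) ((T - R) x) = x := fun x => by
    rw [← hu]; exact congrArg (fun A : X →L[ℂ] X => A x) u.inv_mul
  have h2 : ∀ x, (T - R) ((↑u⁻¹ : X →L[ℂ] X) x) = x := fun x => by
    rw [← hu]; exact congrArg (fun A : X →L[ℂ] X => A x) u.mul_inv
  constructor
  · refine IsFredholm.of_isQuasiInverse (v := (↑u⁻¹ : X →L[ℂ] X)) ⟨?_, ?_⟩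
    · refine LinearMap.FiniteRangeSetoid.equiv_iff_hasFiniteRange.2 ?_
      have : ((↑u⁻¹ : X →L[ℂ] X) : X →ₗ[ℂ] X) ∘ₗ (T : X →ₗ[ℂ] X) - LinearMap.id
          = ((↑u⁻¹ : X →L[ℂ] X) : X →ₗ[ℂ] X) ∘ₗ (R : X →ₗ[ℂ] X) := by
        ext x
        have := h1 x
        simp only [sub_apply, map_sub] at this
        simp only [LinearMap.sub_apply, LinearMap.comp_apply, LinearMap.id_apply, coe_coe]
        rw [sub_eq_iff_eq_add, ← sub_eq_iff_eq_add']; exact this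
      rw [this]
      exact hR.comp_left _
    · refine LinearMap.FiniteRangeSetoid.equiv_iff_hasFiniteRange.2 ?_
      have : (T : X →ₗ[ℂ] X) ∘ₗ ((↑u⁻¹ : X →L[ℂ] X) : X →ₗ[ℂ] X) - LinearMap.id
          = (R : X →ₗ[ℂ] X) ∘ₗ ((↑u⁻¹ : X →L[ℂ] X) : X →ₗ[ℂ] X) := by
        ext x
        have := h2 x
        simp only [sub_apply] at this
        simp only [LinearMap.sub_apply, LinearMap.comp_apply, LinearMap.id_apply, coe_coe]
        rw [sub_eq_iff_eq_add, add_comm, ← sub_eq_iff_eq_add]; exact this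
      rw [this]
      exact hR.comp_right _
  · have hb : Function.Bijective ((T - R : X →L[ℂ] X) : X →ₗ[ℂ] X) :=
      ⟨Function.LeftInverse.injective h1, Function.RightInverse.surjective h2⟩
    obtain ⟨hb1, hb2⟩ := linIndex_of_bijective hb
    obtain ⟨hr1, hr2⟩ := linIndex_id_add
      (hR.comp_left ((↑u⁻¹ : X →L[ℂ] X) : X →ₗ[ℂ] X))
    -- With `T - R` invertible, `T = (T - R)(1 + (T - R)⁻¹R)`: a bijection times a finite rank
    -- perturbation of the identity.
    have key : (T : X →ₗ[ℂ] X) = ((T - R : X →L[ℂ] X) : X →ₗ[ℂ] X) ∘ₗ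
        (LinearMap.id + ((↑u⁻¹ : X →L[ℂ] X) : X →ₗ[ℂ] X) ∘ₗ (R : X →ₗ[ℂ] X)) := by
      ext x
      have := h2 (R x)
      simp only [LinearMap.comp_apply, LinearMap.add_apply, LinearMap.id_apply, coe_coe, map_add,
        this]
      simp
    rw [key, (finiteKerCoker_comp_and_index hr1 hb1).2, hb2, hr2, add_zero]

/-- An operator which is invertible modulo compact operators is Fredholm. -/
theorem isFredholm_of_compact {T : X →L[ℂ] Y} {S : Y →L[ℂ] X}
    (h1 : IsCompactOperator (S ∘L T - 1 : X →L[ℂ] X))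
    (h2 : IsCompactOperator (T ∘L S - 1 : Y →L[ℂ] Y)) : IsFredholm T := by
  obtain ⟨v, hv⟩ := (isFredholm_of_sub_one_compact _ h1).1.exists_isQuasiInverse
  obtain ⟨w, hw⟩ := (isFredholm_of_sub_one_compact _ h2).1.exists_isQuasiInverse
  have hl : (v ∘L S : Y →L[ℂ] X).toLinearMap.IsLeftQuasiInverse T.toLinearMap := hv.1
  have hr : (S ∘L w : Y →L[ℂ] X).toLinearMap.IsRightQuasiInverse T.toLinearMap := hw.2
  refine IsFredholm.of_isQuasiInverse (v := v ∘L S) ⟨hl, ?_⟩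
  -- A left and a right quasi-inverse agree modulo finite rank, by the usual computation `a = a(Tb)
  -- = (aT)b = b`.
  have e : (v ∘L S : Y →L[ℂ] X).toLinearMap ≈ (S ∘L w : Y →L[ℂ] X).toLinearMap := by
    set a := (v ∘L S : Y →L[ℂ] X).toLinearMap
    set b := (S ∘L w : Y →L[ℂ] X).toLinearMap
    calc a = a ∘ₗ LinearMap.id := rfl
      _ ≈ a ∘ₗ (T.toLinearMap ∘ₗ b) :=
        LinearMap.FiniteRangeSetoid.equiv_comp_left (Setoid.symm hr)
      _ = (a ∘ₗ T.toLinearMap) ∘ₗ b := rfl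
      _ ≈ LinearMap.id ∘ₗ b := LinearMap.FiniteRangeSetoid.equiv_comp_right hl
      _ = b := rfl
  exact LinearMap.IsRightQuasiInverse.congr hr e (Setoid.refl _)

omit [CompleteSpace X] [CompleteSpace Y] in
theorem isCompactOperator_of_hasFiniteRange {T : X →L[ℂ] Y}
    (hT : (T : X →ₗ[ℂ] Y).HasFiniteRange) : IsCompactOperator T := by
  have : FiniteDimensional ℂ (T : X →ₗ[ℂ] Y).range := Module.Finite.of_fg hT
  have h : IsCompactOperator (T.codRestrict (T : X →ₗ[ℂ] Y).range fun x => ⟨x, rfl⟩) :=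
    isCompactOperator_of_locallyCompactSpace_dom
      (T.codRestrict (T : X →ₗ[ℂ] Y).range fun x => ⟨x, rfl⟩)
  exact h.clm_comp (T : X →ₗ[ℂ] Y).range.subtypeL

/-- Fredholmness is stable under compact perturbations. -/
theorem isFredholm_of_sub_compact {A B : X →L[ℂ] Y} (hA : IsFredholm A)
    (h : IsCompactOperator (B - A : X →L[ℂ] Y)) : IsFredholm B := by
  obtain ⟨v, hv⟩ := hA.exists_isQuasiInverse
  have c1 : IsCompactOperator (v ∘L A - 1 : X →L[ℂ] X) :=
    isCompactOperator_of_hasFiniteRange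
      (LinearMap.FiniteRangeSetoid.equiv_iff_hasFiniteRange.1 hv.1)
  have c2 : IsCompactOperator (A ∘L v - 1 : Y →L[ℂ] Y) :=
    isCompactOperator_of_hasFiniteRange
      (LinearMap.FiniteRangeSetoid.equiv_iff_hasFiniteRange.1 hv.2)
  have e1 : v ∘L B - 1 = (v ∘L A - 1) + v ∘L (B - A) := by
    rw [comp_sub]; abel
  have e2 : B ∘L v - 1 = (A ∘L v - 1) + (B - A) ∘L v := by
    rw [sub_comp]; abel
  refine isFredholm_of_compact (S := v) ?_ ?_
  · rw [e1]; exact isCompactOperator_add c1 (h.clm_comp v)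
  · rw [e2]; exact isCompactOperator_add c2 (h.comp_clm v)

end Compact

/-! ### Relative index of a pair of subspaces -/

section RelIndex

variable {H : Type*} [NormedAddCommGroup H] [InnerProductSpace ℂ H]

/-- The relative index `dim (M ∩ Nᗮ) - dim (N ∩ Mᗮ)` of two closed subspaces. -/
def relIndex (M N : Submodule ℂ H) : ℤ :=
  (finrank ℂ (M ⊓ Nᗮ : Submodule ℂ H) : ℤ) - (finrank ℂ (N ⊓ Mᗮ : Submodule ℂ H) : ℤ)

theorem relIndex_symm (M N : Submodule ℂ H) : relIndex M N = - relIndex N M := by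
  simp [relIndex]

/-- The difference of the projections acts as the identity on `M ∩ Nᗮ` and as minus the identity on
`N ∩ Mᗮ`, so both are trivial once its norm is below one. -/
theorem relIndex_eq_zero_of_norm_lt (M N : Submodule ℂ H) [M.HasOrthogonalProjection]
    [N.HasOrthogonalProjection] (h : ‖M.starProjection - N.starProjection‖ < 1) :
    relIndex M N = 0 := by
  have key : ∀ (M N : Submodule ℂ H) [M.HasOrthogonalProjection]
      [N.HasOrthogonalProjection], ‖M.starProjection - N.starProjection‖ < 1 → M ⊓ Nᗮ = ⊥ := by
    intro M N _ _ h
    rw [Submodule.eq_bot_iff]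
    rintro x ⟨hx1, hx2⟩
    by_contra hx
    have h1 : (M.starProjection - N.starProjection) x = x := by
      rw [sub_apply, Submodule.starProjection_eq_self_iff.2 hx1,
        (Submodule.starProjection_apply_eq_zero_iff _).2 hx2, sub_zero]
    have h2 := (M.starProjection - N.starProjection).le_opNorm x
    rw [h1] at h2
    have : 0 < ‖x‖ := norm_pos_iff.2 hx
    nlinarith
  rw [relIndex, key M N h, key N M (by rwa [norm_sub_rev])]
  simp

theorem relIndex_of_le {M N : Submodule ℂ H} [M.HasOrthogonalProjection]
    [N.HasOrthogonalProjection] (h : M ≤ N) :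
    relIndex N M = finrank ℂ (N ⊓ Mᗮ : Submodule ℂ H) := by
  have : M ⊓ Nᗮ = ⊥ := by
    rw [Submodule.eq_bot_iff]
    rintro x ⟨hx1, hx2⟩
    exact inner_self_eq_zero.1 (hx2 x (h hx1))
  rw [relIndex, this]
  simp

theorem range_starProjection_sub {M N : Submodule ℂ H} [M.HasOrthogonalProjection]
    [N.HasOrthogonalProjection] (h : M ≤ N) :
    (N.starProjection - M.starProjection : H →L[ℂ] H).range = N ⊓ Mᗮ := by
  have hMN : ∀ x, M.starProjection (N.starProjection x) = M.starProjection x := fun x =>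
    congrArg (fun A : H →L[ℂ] H => A x) (Submodule.starProjection_comp_starProjection_of_le h)
  ext y
  constructor
  · rintro ⟨x, rfl⟩
    refine ⟨Submodule.sub_mem _ (Submodule.starProjection_apply_mem _ _)
      (h (Submodule.starProjection_apply_mem _ _)), ?_⟩
    rw [SetLike.mem_coe, ← Submodule.starProjection_apply_eq_zero_iff]
    simp only [coe_coe, sub_apply, map_sub, hMN]
    rw [Submodule.starProjection_eq_self_iff.2 (Submodule.starProjection_apply_mem _ _), sub_self]
  · rintro ⟨h1, h2⟩
    refine ⟨y, ?_⟩
    simp only [coe_coe, sub_apply]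
    rw [Submodule.starProjection_eq_self_iff.2 h1,
      (Submodule.starProjection_apply_eq_zero_iff _).2 h2, sub_zero]

/-- The compression `M → N`, `x ↦ P_N x`. -/
def compress (M N : Submodule ℂ H) [N.HasOrthogonalProjection] : M →L[ℂ] N :=
  N.orthogonalProjectionOnto ∘L M.subtypeL

theorem coe_compress (M N : Submodule ℂ H) [N.HasOrthogonalProjection] (x : M) :
    (compress M N x : H) = N.starProjection x := rfl

variable [CompleteSpace H]

omit [CompleteSpace H] in
/-- A closed subspace on which a compact operator is the identity is finite dimensional. -/
theorem finiteDimensional_of_compact_eq_self {A : H →L[ℂ] H} (hA : IsCompactOperator A)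
    {S : Submodule ℂ H} (hS : IsClosed (S : Set H)) (h : ∀ x ∈ S, A x = x) :
    FiniteDimensional ℂ S := by
  have h1 := hA.restrict (f := (A : H →ₗ[ℂ] H)) (V := S) (fun x hx => by
    rw [coe_coe, h x hx]; exact hx) hS
  refine FiniteDimensional.of_isCompactOperator_id (𝕜 := ℂ) ?_
  have e : (id : S → S) = (A : H →ₗ[ℂ] H).restrict (fun x hx => by
      rw [coe_coe, h x hx]; exact hx) := funext fun x => Subtype.ext (h x x.2).symm
  rw [e]
  exact h1

omit [CompleteSpace H] in
theorem isClosed_of_hasOrthogonalProjection (M : Submodule ℂ H) [M.HasOrthogonalProjection] :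
    IsClosed (M : Set H) := by
  have : (M : Set H) = {x | M.starProjection x = x} := by
    ext x; exact Submodule.starProjection_eq_self_iff.symm
  rw [this]
  exact isClosed_eq M.starProjection.continuous continuous_id

omit [CompleteSpace H] in
theorem finiteDimensional_inf_orthogonal {M N : Submodule ℂ H} [M.HasOrthogonalProjection]
    [N.HasOrthogonalProjection]
    (h : IsCompactOperator (M.starProjection - N.starProjection : H →L[ℂ] H)) :
    FiniteDimensional ℂ (M ⊓ Nᗮ : Submodule ℂ H) := by
  refine finiteDimensional_of_compact_eq_self h ?_ ?_
  · exact (isClosed_of_hasOrthogonalProjection M).inter N.isClosed_orthogonal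
  · rintro x ⟨hx1, hx2⟩
    rw [sub_apply, Submodule.starProjection_eq_self_iff.2 hx1,
      (Submodule.starProjection_apply_eq_zero_iff _).2 hx2, sub_zero]

omit [CompleteSpace H] in
theorem compress_comp_sub_one_compact (M N : Submodule ℂ H) [M.HasOrthogonalProjection]
    [N.HasOrthogonalProjection]
    (h : IsCompactOperator (N.starProjection - M.starProjection : H →L[ℂ] H)) :
    IsCompactOperator (compress N M ∘L compress M N - 1 : M →L[ℂ] M) := by
  have : compress N M ∘L compress M N - 1 =
      M.orthogonalProjectionOnto ∘L (N.starProjection - M.starProjection) ∘L M.subtypeL := by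
    ext x
    change M.starProjection (N.starProjection x) - (x : H) =
      M.starProjection (N.starProjection x - M.starProjection x)
    have hx : M.starProjection (x : H) = x := Submodule.starProjection_eq_self_iff.2 x.2
    rw [hx, map_sub, hx]
  rw [this]
  exact isCompactOperator_comp_left (isCompactOperator_comp_right h M.subtypeL)
    M.orthogonalProjectionOnto

omit [CompleteSpace H] in
theorem isFredholm_compress {M N : Submodule ℂ H} [M.HasOrthogonalProjection]
    [N.HasOrthogonalProjection] [CompleteSpace M] [CompleteSpace N]
    (h : IsCompactOperator (M.starProjection - N.starProjection : H →L[ℂ] H)) :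
    IsFredholm (compress M N) := by
  refine isFredholm_of_compact (S := compress N M)
    (compress_comp_sub_one_compact M N (isCompactOperator_sub_comm h))
    (compress_comp_sub_one_compact N M h)

-- This turns the relative index into a Fredholm index, from which additivity is inherited. A vector
-- of `M` killed by `P_N` lies in `Nᗮ`; the range is closed, so the cokernel is its orthogonal
-- complement in `N`, which self-adjointness of `P_N` identifies with `N ∩ Mᗮ`.
omit [CompleteSpace H] in
theorem linIndex_compress {M N : Submodule ℂ H} [M.HasOrthogonalProjection]
    [N.HasOrthogonalProjection] [CompleteSpace M] [CompleteSpace N]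
    (h : IsCompactOperator (M.starProjection - N.starProjection : H →L[ℂ] H)) :
    linIndex (compress M N : M →ₗ[ℂ] N) = relIndex M N := by
  have hF := isFredholm_compress h
  have e1 : finrank ℂ (compress M N : M →ₗ[ℂ] N).ker
      = finrank ℂ (M ⊓ Nᗮ : Submodule ℂ H) := by
    have : (compress M N : M →ₗ[ℂ] N).ker.map M.subtype = M ⊓ Nᗮ := by
      ext x
      simp only [Submodule.mem_map, LinearMap.mem_ker, coe_coe, Submodule.subtype_apply,
        Submodule.mem_inf]
      constructor
      · rintro ⟨y, hy, rfl⟩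
        refine ⟨y.2, ?_⟩
        rw [← Submodule.starProjection_apply_eq_zero_iff, ← coe_compress, hy]; rfl
      · rintro ⟨h1, h2⟩
        refine ⟨⟨x, h1⟩, ?_, rfl⟩
        rw [← Submodule.starProjection_apply_eq_zero_iff] at h2
        exact Subtype.ext h2
    rw [← this]
    exact (Submodule.equivMapOfInjective M.subtype M.subtype_injective _).finrank_eq
  have e2 : finrank ℂ (N ⧸ (compress M N : M →ₗ[ℂ] N).range)
      = finrank ℂ (N ⊓ Mᗮ : Submodule ℂ H) := by
    have hc := hF.isClosed_range
    have : CompleteSpace (compress M N : M →ₗ[ℂ] N).range :=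
      hc.completeSpace_coe
    rw [(Submodule.quotientEquivOfIsCompl _ _
      (Submodule.isCompl_orthogonal (K := (compress M N : M →ₗ[ℂ] N).range))).finrank_eq]
    have : ((compress M N : M →ₗ[ℂ] N).range)ᗮ.map N.subtype = N ⊓ Mᗮ := by
      ext x
      simp only [Submodule.mem_map, Submodule.subtype_apply, Submodule.mem_inf]
      constructor
      · rintro ⟨y, hy, rfl⟩
        refine ⟨y.2, fun z hz => ?_⟩
        have := hy _ ⟨⟨z, hz⟩, rfl⟩
        rw [Submodule.coe_inner] at this
        change inner ℂ (N.starProjection z) (y : H) = 0 at this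
        rwa [Submodule.inner_starProjection_left_eq_right,
          Submodule.starProjection_eq_self_iff.2 y.2] at this
      · rintro ⟨h1, h2⟩
        refine ⟨⟨x, h1⟩, ?_, rfl⟩
        rintro _ ⟨z, rfl⟩
        rw [Submodule.coe_inner]
        change inner ℂ (N.starProjection z) x = 0
        rw [Submodule.inner_starProjection_left_eq_right,
          Submodule.starProjection_eq_self_iff.2 h1]
        exact h2 z z.2
    rw [← this]
    exact (Submodule.equivMapOfInjective N.subtype N.subtype_injective _).finrank_eq
  rw [linIndex, e1, e2, relIndex]

/-- Additivity of the relative index for subspaces whose projections differ by compact operators. -/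
theorem relIndex_add {M N L : Submodule ℂ H} [M.HasOrthogonalProjection]
    [N.HasOrthogonalProjection] [L.HasOrthogonalProjection]
    (h1 : IsCompactOperator (M.starProjection - N.starProjection : H →L[ℂ] H))
    (h2 : IsCompactOperator (N.starProjection - L.starProjection : H →L[ℂ] H)) :
    relIndex M N + relIndex N L = relIndex M L := by
  have : CompleteSpace M := (isClosed_of_hasOrthogonalProjection M).completeSpace_coe
  have : CompleteSpace N := (isClosed_of_hasOrthogonalProjection N).completeSpace_coe
  have : CompleteSpace L := (isClosed_of_hasOrthogonalProjection L).completeSpace_coe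
  have h3 : IsCompactOperator (L.starProjection - M.starProjection : H →L[ℂ] H) :=
    isCompactOperator_sub_comm (isCompactOperator_sub_trans h1 h2)
  -- Going round the triangle `M → N → L → M` is a compact perturbation of the identity, so the
  -- three indices sum to zero.
  have k : IsCompactOperator
      (compress L M ∘L compress N L ∘L compress M N - 1 : M →L[ℂ] M) := by
    have e : compress L M ∘L compress N L ∘L compress M N - 1 =
        M.orthogonalProjectionOnto ∘L L.starProjection ∘L
          (N.starProjection - M.starProjection) ∘L M.subtypeL +
        M.orthogonalProjectionOnto ∘L (L.starProjection - M.starProjection) ∘L M.subtypeL := by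
      ext x
      change M.starProjection (L.starProjection (N.starProjection x)) - (x : H) =
        M.starProjection (L.starProjection (N.starProjection x - M.starProjection x)) +
        M.starProjection (L.starProjection x - M.starProjection x)
      simp only [map_sub, Submodule.starProjection_eq_self_iff.2 x.2]
      abel
    rw [e]
    refine isCompactOperator_add ?_ (isCompactOperator_comp_left
      (isCompactOperator_comp_right h3 M.subtypeL) M.orthogonalProjectionOnto)
    have h1' := isCompactOperator_sub_comm h1
    exact ((h1'.comp_clm M.subtypeL).clm_comp L.starProjection).clm_comp
      M.orthogonalProjectionOnto
  have f1 := finiteKerCoker_of_isFredholm (isFredholm_compress h1)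
  have f2 := finiteKerCoker_of_isFredholm (isFredholm_compress h2)
  have f3 := finiteKerCoker_of_isFredholm (isFredholm_compress h3)
  have i := (isFredholm_of_sub_one_compact _ k).2
  have j := finiteKerCoker_comp_and_index f1 f2
  have l := (finiteKerCoker_comp_and_index j.1 f3).2
  rw [j.2, linIndex_compress h1, linIndex_compress h2, linIndex_compress h3] at l
  have l' : linIndex ((compress L M ∘L compress N L ∘L compress M N : M →L[ℂ] M) : M →ₗ[ℂ] M)
      = relIndex L M + (relIndex N L + relIndex M N) := l
  rw [i, relIndex_symm L M] at l'
  omega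

end RelIndex

/-! ### Spectral subspaces through continuous functional calculus -/

section Spectral

variable {H : Type*} [NormedAddCommGroup H] [InnerProductSpace ℂ H] [CompleteSpace H]

/-- The range of the spectral projection `χ_{(-∞, c]}(F)`. -/
def specSub (F : H →L[ℂ] H) (c : ℝ) : Submodule ℂ H :=
  (cfc (fun x : ℝ => max (x - c) 0) F).ker

instance (F : H →L[ℂ] H) (c : ℝ) : (specSub F c).HasOrthogonalProjection :=
  inferInstanceAs (cfc (fun x : ℝ => max (x - c) 0) F).ker.HasOrthogonalProjection

omit [CompleteSpace H] in
theorem clm_one_apply (x : H) : (1 : H →L[ℂ] H) x = x := rfl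

theorem specProjIic_eq (F : H →L[ℂ] H) (c : ℝ) :
    specProjIic F c = (specSub F c).starProjection := rfl

theorem mem_specSub {F : H →L[ℂ] H} {c : ℝ} {x : H} :
    x ∈ specSub F c ↔ cfc (fun x : ℝ => max (x - c) 0) F x = 0 := Iff.rfl

theorem cfc_apply_apply {F : H →L[ℂ] H} {f g h : ℝ → ℝ} (hf : Continuous f)
    (hg : Continuous g) (e : ∀ x, f x * g x = h x) (x : H) :
    cfc f F (cfc g F x) = cfc h F x := by
  have : h = fun x => f x * g x := funext fun x => (e x).symm
  rw [this, cfc_mul f g F hf.continuousOn hg.continuousOn]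
  rfl

theorem inner_cfc_left (F : H →L[ℂ] H) (f : ℝ → ℝ) (x y : H) :
    inner ℂ (cfc f F x) y = inner ℂ x (cfc f F y) := by
  have h : IsSelfAdjoint (cfc f F) := cfc_predicate f F
  rw [← adjoint_inner_right, h.adjoint_eq]

/-- The continuous cutoff which is `0` on `(-∞, a]`, `1` on `[b, ∞)` and affine in between. -/
def ramp (a b x : ℝ) : ℝ := max 0 (min 1 ((x - a) / (b - a)))

theorem continuous_ramp (a b : ℝ) : Continuous (ramp a b) := by
  unfold ramp; fun_prop

/-- `ramp a b` is a continuous multiple of `(x - a)₊`, with factor `1 / max (b - a) (x - a)`. -/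
theorem ramp_apply_of_mem {F : H →L[ℂ] H} {a b : ℝ} (hab : a < b) {x : H}
    (hx : x ∈ specSub F a) : cfc (ramp a b) F x = 0 := by
  rw [← cfc_apply_apply (f := fun x => (max (b - a) (x - a))⁻¹) (g := fun x => max (x - a) 0)
    ?_ (by fun_prop) ?_ x, mem_specSub.1 hx, map_zero]
  · refine Continuous.inv₀ (by fun_prop) fun x => ?_
    exact (lt_of_lt_of_le (sub_pos.2 hab) (le_max_left _ _)).ne'
  · intro x
    have h := sub_pos.2 hab
    unfold ramp
    rcases le_total (x - a) 0 with h0 | h0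
    · rw [max_eq_right h0, mul_zero, max_eq_left]
      exact (min_le_right _ _).trans (div_nonpos_of_nonpos_of_nonneg h0 h.le)
    · rw [max_eq_left h0]
      rcases le_total (x - a) (b - a) with h1 | h1
      · rw [max_eq_left h1, min_eq_right ((div_le_one h).2 h1), max_eq_right (by positivity)]
        field_simp
      · rw [max_eq_right h1, min_eq_left ((one_le_div h).2 h1), max_eq_right zero_le_one]
        exact inv_mul_cancel₀ (by linarith)

/-- The function `1 - ramp a b` vanishes wherever `(x - b)₊` does not, so `1 - ramp a b (F)` maps
into the kernel defining `specSub F b`. -/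
theorem sub_ramp_mem (F : H →L[ℂ] H) {a b : ℝ} (hab : a < b) (x : H) :
    x - cfc (ramp a b) F x ∈ specSub F b := by
  rw [mem_specSub, map_sub, sub_eq_zero]
  symm
  refine cfc_apply_apply (by fun_prop) (continuous_ramp a b) (fun x => ?_) x
  have h := sub_pos.2 hab
  unfold ramp
  rcases le_total (x - b) 0 with h0 | h0
  · rw [max_eq_right h0, zero_mul]
  · rw [min_eq_left ((one_le_div h).2 (by linarith)), max_eq_right zero_le_one, mul_one]

theorem specSub_mono (F : H →L[ℂ] H) : Monotone (specSub F) := by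
  intro c d hcd x hx
  rcases hcd.eq_or_lt with rfl | h
  · exact hx
  · have := sub_ramp_mem F h x
    rwa [ramp_apply_of_mem h hx, sub_zero] at this

/-- Put `A = 1 - ramp a b (F)`. It is self-adjoint with range in `specSub F b`, so `‖Ax‖² = ⟨A(Ax),
x⟩ = 0`. -/
theorem ramp_apply_of_mem_orthogonal {F : H →L[ℂ] H} {a b : ℝ}
    (hab : a < b) {x : H} (hx : x ∈ (specSub F b)ᗮ) : cfc (ramp a b) F x = x := by
  rw [eq_comm, ← sub_eq_zero, ← inner_self_eq_zero (𝕜 := ℂ)]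
  have h := hx _ (sub_ramp_mem F hab (x - cfc (ramp a b) F x))
  rw [inner_sub_left, inner_cfc_left, ← inner_sub_right] at h
  exact h

/-- The second factor is `(1 - χ_{(-∞,b]}) + χ_{(-∞,a]}`; the first kills the former summand and
fixes the latter. A flow partition only controls `χ_{(a,b]}`; this identity transfers its norm
continuity to `χ_{(-∞,a]}`. -/
theorem specProjIic_eq_of_specProj {F : H →L[ℂ] H} {a b : ℝ}
    (hab : a < b) :
    specProjIic F a = (1 - cfc (ramp a b) F) ∘L (1 - specProj F a b) := by
  ext x
  have h1 := ramp_apply_of_mem (F := F) hab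
    (Submodule.starProjection_apply_mem (specSub F a) x)
  have h2 := ramp_apply_of_mem_orthogonal hab
    (Submodule.sub_starProjection_mem_orthogonal (K := specSub F b) x)
  simp only [specProj, specProjIic_eq, comp_apply, sub_apply, clm_one_apply, map_sub] at h1 h2 ⊢
  rw [h1, sub_zero, ← sub_eq_zero]
  rw [sub_eq_iff_eq_add] at h2
  rw [h2]
  abel

theorem specProj_range {F : H →L[ℂ] H} {a b : ℝ} (hab : a ≤ b) :
    (specProj F a b).range = specSub F b ⊓ (specSub F a)ᗮ :=
  range_starProjection_sub (specSub_mono F hab)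

theorem finrank_specProj_range {F : H →L[ℂ] H} {a b : ℝ} (hab : a ≤ b) :
    (finrank ℂ (specProj F a b).range : ℤ) = relIndex (specSub F b) (specSub F a) := by
  rw [specProj_range hab, relIndex_of_le (specSub_mono F hab)]

/-- The operator is a continuous bump function of `F`, equal to one on `[a,b]` and zero outside
`(c,d)`. Together with `specSub_eq_of_bump` it makes a spectral gap an open condition: the bump
vanishes at a gap, and norm below one already suffices for a smaller gap. -/
theorem bump_eq_zero {F : H →L[ℂ] H} {a b c d : ℝ} (hca : c < a)
    (hbd : b < d) (h : specSub F c = specSub F d) :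
    cfc (ramp c a) F ∘L (1 - cfc (ramp b d) F) = 0 := by
  ext x
  have := sub_ramp_mem F hbd x
  rw [← h] at this
  exact ramp_apply_of_mem hca this

/-- The bump fixes every vector of `specSub F b` orthogonal to `specSub F a`; an operator of norm
below one fixes only zero. -/
theorem specSub_eq_of_bump {F : H →L[ℂ] H} {a b c d : ℝ} (hca : c < a)
    (hab : a ≤ b) (hbd : b < d) (h : ‖cfc (ramp c a) F ∘L (1 - cfc (ramp b d) F)‖ < 1) :
    specSub F a = specSub F b := by
  refine le_antisymm (specSub_mono F hab) fun x hx => ?_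
  set y := x - (specSub F a).starProjection x with hy
  have h1 : y ∈ specSub F b := Submodule.sub_mem _ hx
    (specSub_mono F hab (Submodule.starProjection_apply_mem _ _))
  have h2 : y ∈ (specSub F a)ᗮ := Submodule.sub_starProjection_mem_orthogonal _
  have h3 : (cfc (ramp c a) F ∘L (1 - cfc (ramp b d) F)) y = y := by
    rw [comp_apply, sub_apply, ramp_apply_of_mem hbd h1, sub_zero, clm_one_apply,
      ramp_apply_of_mem_orthogonal hca h2]
  have h4 := (cfc (ramp c a) F ∘L (1 - cfc (ramp b d) F)).le_opNorm y
  rw [h3] at h4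
  have h5 : y = 0 := by
    by_contra hne
    have : 0 < ‖y‖ := norm_pos_iff.2 hne
    nlinarith
  rw [hy, sub_eq_zero] at h5
  rw [h5]
  exact Submodule.starProjection_apply_mem _ _

theorem continuousOn_cfc_path {γ : ℝ → (H →L[ℂ] H)} {s : Set ℝ} (hγ : ContinuousOn γ s)
    (hsa : ∀ t ∈ s, IsSelfAdjoint (γ t)) {f : ℝ → ℝ} (hf : Continuous f) :
    ContinuousOn (fun t => cfc f (γ t)) s :=
  ContinuousOn.cfc_of_mem_nhdsSet f (s := univ) Filter.univ_mem hγ hsa hf.continuousOn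

/-- For `F² = 1` and `G - F` compact, the spectral projections `χ_{(-∞, a]}(G)` with `a ∈ (-1, 1)`
are compact perturbations of `χ_{(-∞, 0]}(F) = (1 - F) / 2`. -/
theorem specProjIic_sub_compact {F G : H →L[ℂ] H} (hF : F ∘L F = 1) (hG : IsSelfAdjoint G)
    (hc : IsCompactOperator (G - F : H →L[ℂ] H)) {a : ℝ} (ha : a ∈ Ioo (-1 : ℝ) 1) :
    IsCompactOperator (specProjIic G a - (1 / 2 : ℂ) • (1 - F) : H →L[ℂ] H) := by
  set P := specProjIic G a with hP
  have hF' : ∀ x, F (F x) = x := fun x => congrArg (fun A : H →L[ℂ] H => A x) hF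
  have hid : ∀ f : ℝ → ℝ, Continuous f → ∀ x, G (cfc f G x) = cfc (fun t => t * f t) G x := by
    intro f hf x
    have := cfc_apply_apply (F := G) (f := fun t => t) (g := f) continuous_id hf
      (fun t => rfl) x
    rwa [cfc_id' ℝ G] at this
  -- On `(-∞,a]` the function in `g` is `1/(x - 1)`, and on `[a,∞)` the one in `k` is `1/(x + 1)`.
  -- The truncations by `a` avoid the poles, so `g` and `k` invert `G - 1` on the range of `P` and
  -- `G + 1` on that of `1 - P`.
  set g := cfc (fun x : ℝ => (min x a - 1)⁻¹) G with hg
  set k := cfc (fun x : ℝ => (max x a + 1)⁻¹) G with hk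
  have cg : Continuous (fun x : ℝ => (min x a - 1)⁻¹) := by
    refine Continuous.inv₀ (by fun_prop) fun x => ?_
    have := min_le_right x a
    have := ha.2
    exact (by linarith : min x a - 1 < 0).ne
  have ck : Continuous (fun x : ℝ => (max x a + 1)⁻¹) := by
    refine Continuous.inv₀ (by fun_prop) fun x => ?_
    have := le_max_right x a
    have := ha.1
    exact (by linarith : 0 < max x a + 1).ne'
  have e1 : ∀ x, G (g (P x)) - g (P x) = P x := by
    intro x
    have hx : P x ∈ specSub G a := Submodule.starProjection_apply_mem _ _
    have h1 := ramp_apply_of_mem (F := G) (b := a + 1) (by linarith) hx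
    rw [hid _ cg, hg, ← sub_apply, ← cfc_sub _ _ G (by fun_prop) cg.continuousOn]
    have : (fun t : ℝ => t * (min t a - 1)⁻¹ - (min t a - 1)⁻¹)
        = fun t => 1 - (1 - a)⁻¹ * max (t - a) 0 := by
      funext t
      have := ha.2
      have h1 : 1 - a ≠ 0 := by linarith
      have h1' : a - 1 ≠ 0 := by linarith
      rcases le_total t a with h | h
      · have : t - 1 ≠ 0 := by linarith
        rw [min_eq_left h, max_eq_right (by linarith)]
        field_simp
        ring
      · rw [min_eq_right h, max_eq_left (by linarith)]
        have : (a - 1)⁻¹ = - (1 - a)⁻¹ := by rw [← inv_neg, neg_sub]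
        rw [this]
        field_simp
        ring
    rw [this, cfc_sub _ _ G (by fun_prop) (by fun_prop), cfc_const_one ℝ G,
      cfc_const_mul _ _ G (by fun_prop), sub_apply, smul_apply, mem_specSub.1 hx, smul_zero,
      sub_zero, clm_one_apply]
  have e2 : ∀ x, G (k (x - P x)) + k (x - P x) = x - P x := by
    intro x
    have hx : x - P x ∈ (specSub G a)ᗮ := Submodule.sub_starProjection_mem_orthogonal _
    have hx' : cfc (fun t : ℝ => max (a - t) 0) G (x - P x) = 0 := by
      rw [← inner_self_eq_zero (𝕜 := ℂ), inner_cfc_left]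
      rw [← inner_conj_symm]
      have : inner ℂ (cfc (fun t : ℝ => max (a - t) 0) G
        (cfc (fun t : ℝ => max (a - t) 0) G (x - P x))) (x - P x) = 0 := by
        refine hx _ ?_
        rw [mem_specSub, cfc_apply_apply (h := fun _ => 0) (by fun_prop) (by fun_prop),
          cfc_const_zero]
        · rfl
        · intro t
          rcases le_total t a with h | h
          · rw [max_eq_right (by linarith), zero_mul]
          · rw [max_eq_right (b := (0:ℝ)) (a := a - t) (by linarith), mul_zero]
      rw [this, map_zero]
    rw [hid _ ck, hk, ← add_apply, ← cfc_add G _ _ (by fun_prop) ck.continuousOn]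
    have : (fun t : ℝ => t * (max t a + 1)⁻¹ + (max t a + 1)⁻¹)
        = fun t => 1 - (1 + a)⁻¹ * max (a - t) 0 := by
      funext t
      have := ha.1
      have h1 : 1 + a ≠ 0 := by linarith
      have h1' : a + 1 ≠ 0 := by linarith
      rcases le_total t a with h | h
      · rw [max_eq_right h, max_eq_left (by linarith)]
        field_simp
        ring
      · have : t + 1 ≠ 0 := by linarith
        rw [max_eq_left h, max_eq_right (by linarith)]
        field_simp
        ring
    rw [this, cfc_sub _ _ G (by fun_prop) (by fun_prop), cfc_const_one ℝ G,
      cfc_const_mul _ _ G (by fun_prop), sub_apply, smul_apply, hx', smul_zero,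
      sub_zero, clm_one_apply]
  -- Start from `P - (1 - F)/2 = (1 + F)P/2 - (1 - F)(1 - P)/2`, insert `P = (G - 1)gP` and `1 - P =
  -- (G + 1)k(1 - P)`, and use `(1 + F)(F - 1) = 0 = (1 - F)(F + 1)` to replace `G ∓ 1` by `G - F`.
  have key : P - (1 / 2 : ℂ) • (1 - F) = (1 / 2 : ℂ) • ((1 + F) ∘L (G - F) ∘L g ∘L P) +
      (-(1 / 2) : ℂ) • ((1 - F) ∘L (G - F) ∘L k ∘L (1 - P)) := by
    ext x
    have a1 := e1 x
    have a2 := e2 x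
    rw [sub_eq_iff_eq_add] at a1
    rw [← eq_sub_iff_add_eq] at a2
    simp only [sub_apply, add_apply, smul_apply, comp_apply, clm_one_apply]
    rw [a1, a2]
    simp only [map_sub, map_add, hF']
    module
  rw [key]
  exact isCompactOperator_add
    (isCompactOperator_smul (isCompactOperator_comp_left
      (isCompactOperator_comp_right hc (g ∘L P)) (1 + F)) _)
    (isCompactOperator_smul (isCompactOperator_comp_left
      (isCompactOperator_comp_right hc (k ∘L (1 - P))) (1 - F)) _)

end Spectral

/-! ### Spectral flow as a relative index -/

section Flow

variable {H : Type*} [NormedAddCommGroup H] [InnerProductSpace ℂ H] [CompleteSpace H]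

theorem specSub_sub_compact {F G G' : H →L[ℂ] H} (hF : F ∘L F = 1) (hG : IsSelfAdjoint G)
    (hc : IsCompactOperator (G - F : H →L[ℂ] H)) (hG' : IsSelfAdjoint G')
    (hc' : IsCompactOperator (G' - F : H →L[ℂ] H)) {a b : ℝ} (ha : a ∈ Ioo (-1 : ℝ) 1)
    (hb : b ∈ Ioo (-1 : ℝ) 1) :
    IsCompactOperator
      ((specSub G a).starProjection - (specSub G' b).starProjection : H →L[ℂ] H) :=
  isCompactOperator_sub_trans (specProjIic_sub_compact hF hG hc ha)
    (isCompactOperator_sub_comm (specProjIic_sub_compact hF hG' hc' hb))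

/-- Every interval in `(-1, 1)` contains a gap of the discrete spectrum. -/
theorem exists_specSub_gap {F G : H →L[ℂ] H} (hF : F ∘L F = 1) (hG : IsSelfAdjoint G)
    (hc : IsCompactOperator (G - F : H →L[ℂ] H)) {c d : ℝ} (hc1 : -1 ≤ c) (hd1 : d ≤ 1)
    (hcd : c < d) :
    ∃ x ∈ Ioo c d, ∃ y ∈ Ioo x d, specSub G x = specSub G y := by
  obtain ⟨e, hce, hed⟩ := exists_between hcd
  have he : e ∈ Ioo (-1 : ℝ) 1 := ⟨by linarith, by linarith⟩
  -- `n x` is the dimension of the spectral subspace for `(x, e]`, finite for `-1 < x < e` and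
  -- nonincreasing there. Where it attains its minimum it must stay constant to the right, which is
  -- a gap. Starting at `m0 > c` keeps `x` away from `-1`.
  let n : ℝ → ℕ := fun x => finrank ℂ (specSub G e ⊓ (specSub G x)ᗮ : Submodule ℂ H)
  obtain ⟨m0, hcm, hme⟩ := exists_between hce
  obtain ⟨x, ⟨hx1, hx2⟩, hmin⟩ :
      ∃ x ∈ Ico m0 e, ∀ y ∈ Ico m0 e, n x ≤ n y := by
    have hne : (n '' Ico m0 e).Nonempty := ⟨_, m0, ⟨le_rfl, hme⟩, rfl⟩
    obtain ⟨x, hx, hxe⟩ := Nat.sInf_mem hne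
    exact ⟨x, hx, fun y hy => hxe ▸ Nat.sInf_le ⟨y, hy, rfl⟩⟩
  obtain ⟨y, hxy, hye⟩ := exists_between hx2
  refine ⟨x, ⟨by linarith, by linarith⟩, y, ⟨hxy, by linarith⟩, ?_⟩
  have hmono := specSub_mono G
  have hle : (specSub G e ⊓ (specSub G y)ᗮ : Submodule ℂ H) ≤ specSub G e ⊓ (specSub G x)ᗮ :=
    inf_le_inf le_rfl (Submodule.orthogonal_le (hmono hxy.le))
  have : FiniteDimensional ℂ (specSub G e ⊓ (specSub G x)ᗮ : Submodule ℂ H) :=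
    finiteDimensional_inf_orthogonal (specSub_sub_compact hF hG hc hG hc he
      ⟨by linarith, by linarith⟩)
  have heq := Submodule.eq_of_le_of_finrank_le hle (hmin y ⟨by linarith, hye⟩)
  refine le_antisymm (hmono hxy.le) fun z hz => ?_
  have h1 : z - (specSub G x).starProjection z ∈
      (specSub G e ⊓ (specSub G x)ᗮ : Submodule ℂ H) :=
    ⟨Submodule.sub_mem _ (hmono hye.le hz) (hmono hx2.le (Submodule.starProjection_apply_mem _ _)),
      Submodule.sub_starProjection_mem_orthogonal _⟩
  rw [← heq] at h1
  have h2 : z - (specSub G x).starProjection z ∈ specSub G y :=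
    Submodule.sub_mem _ hz (hmono hxy.le (Submodule.starProjection_apply_mem _ _))
  have h3 := inner_self_eq_zero.1 (h1.2 _ h2)
  rw [sub_eq_zero] at h3
  rw [h3]
  exact Submodule.starProjection_apply_mem _ _

/-- A spectral gap in `(c, d)` persists nearby. -/
theorem eventually_specSub_eq {F : H →L[ℂ] H} (hF : F ∘L F = 1) {γ : ℝ → (H →L[ℂ] H)}
    {s : Set ℝ} (hγ : ContinuousOn γ s) (hsa : ∀ t ∈ s, IsSelfAdjoint (γ t))
    (hc : ∀ t ∈ s, IsCompactOperator (γ t - F : H →L[ℂ] H)) {t₀ : ℝ} (ht₀ : t₀ ∈ s) {c d : ℝ}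
    (hc1 : -1 ≤ c) (hd1 : d ≤ 1) (hcd : c < d) :
    ∃ a ∈ Ioo c d, ∃ b ∈ Ioo a d, ∀ᶠ t in nhdsWithin t₀ s, specSub (γ t) a = specSub (γ t) b := by
  obtain ⟨x, hx, y, hy, hxy⟩ := exists_specSub_gap hF (hsa t₀ ht₀) (hc t₀ ht₀) hc1 hd1 hcd
  obtain ⟨a, hxa, hay⟩ := exists_between hy.1
  obtain ⟨b, hab, hby⟩ := exists_between hay
  refine ⟨a, ⟨hx.1.trans hxa, hay.trans hy.2⟩, b, ⟨hab, hby.trans hy.2⟩, ?_⟩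
  have h1 := continuousOn_cfc_path hγ hsa (continuous_ramp x a)
  have h2 := continuousOn_cfc_path hγ hsa (continuous_ramp b y)
  have h3 : ContinuousOn
      (fun t => ‖cfc (ramp x a) (γ t) ∘L (1 - cfc (ramp b y) (γ t))‖) s :=
    (h1.mul (continuousOn_const.sub h2)).norm
  have h4 := Filter.Tendsto.eventually_lt_const (u := 1) (by
    rw [bump_eq_zero hxa hby hxy, norm_zero]; exact zero_lt_one) (h3 t₀ ht₀).tendsto
  filter_upwards [h4] with t ht
  exact specSub_eq_of_bump hxa hab.le hby ht

theorem continuousOn_specProjIic {γ : ℝ → (H →L[ℂ] H)} {s : Set ℝ} (hγ : ContinuousOn γ s)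
    (hsa : ∀ t ∈ s, IsSelfAdjoint (γ t)) {a b : ℝ} (hab : a < b)
    (hc : ContinuousOn (fun t => specProj (γ t) a b) s) :
    ContinuousOn (fun t => specProjIic (γ t) a) s := by
  have h1 := continuousOn_cfc_path hγ hsa (continuous_ramp a b)
  have : ContinuousOn
      (fun t => (1 - cfc (ramp a b) (γ t)) ∘L (1 - specProj (γ t) a b)) s :=
    (continuousOn_const.sub h1).mul (continuousOn_const.sub hc)
  exact this.congr fun t _ => specProjIic_eq_of_specProj hab

theorem continuousOn_specProjIic_of_gap {γ : ℝ → (H →L[ℂ] H)} {s : Set ℝ}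
    (hγ : ContinuousOn γ s) (hsa : ∀ t ∈ s, IsSelfAdjoint (γ t)) {a b : ℝ} (hab : a < b)
    (hgap : ∀ t ∈ s, specSub (γ t) a = specSub (γ t) b) :
    ContinuousOn (fun t => specProjIic (γ t) a) s := by
  refine continuousOn_specProjIic hγ hsa hab ?_
  refine (continuousOn_const (c := 0)).congr fun t ht => ?_
  simp only [specProj, specProjIic_eq]
  rw [sub_eq_zero]
  congr 1
  exact (hgap t ht).symm

/-- By additivity and vanishing at small distance, the relative index to a fixed reference is
locally constant, hence constant on a preconnected set; at the reference itself it is zero. -/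
theorem relIndex_eq_zero_of_continuousOn {F : H →L[ℂ] H} (hF : F ∘L F = 1)
    {γ : ℝ → (H →L[ℂ] H)} {s : Set ℝ} (hs : IsPreconnected s)
    (hsa : ∀ t ∈ s, IsSelfAdjoint (γ t))
    (hc : ∀ t ∈ s, IsCompactOperator (γ t - F : H →L[ℂ] H)) {a : ℝ} (ha : a ∈ Ioo (-1 : ℝ) 1)
    (hcont : ContinuousOn (fun t => specProjIic (γ t) a) s) {t t' : ℝ} (ht : t ∈ s)
    (ht' : t' ∈ s) : relIndex (specSub (γ t) a) (specSub (γ t') a) = 0 := by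
  have hcomp : ∀ x ∈ s, ∀ y ∈ s, IsCompactOperator
      ((specSub (γ x) a).starProjection - (specSub (γ y) a).starProjection : H →L[ℂ] H) :=
    fun x hx y hy => specSub_sub_compact hF (hsa x hx) (hc x hx) (hsa y hy) (hc y hy) ha ha
  have key : ContinuousOn (fun x => relIndex (specSub (γ x) a) (specSub (γ t') a)) s := by
    intro x hx
    have h1 : ContinuousWithinAt (fun y => ‖specProjIic (γ y) a - specProjIic (γ x) a‖) s x :=
      ((hcont x hx).sub continuousWithinAt_const).norm
    have h2 := Filter.Tendsto.eventually_lt_const (u := 1)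
      (by rw [sub_self, norm_zero]; exact zero_lt_one) h1.tendsto
    refine (continuousWithinAt_const (b := relIndex (specSub (γ x) a) (specSub (γ t') a))
      ).congr_of_eventuallyEq ?_ rfl
    filter_upwards [h2, self_mem_nhdsWithin] with y hy hys
    rw [← relIndex_add (hcomp y hys x hx) (hcomp x hx t' ht'),
      relIndex_eq_zero_of_norm_lt (specSub (γ y) a) (specSub (γ x) a) hy, zero_add]
  have := hs.constant key ht ht'
  rw [this]
  simp [relIndex]

/-- The spectral flow of a path of compact perturbations of a symmetry is the relative index of
the negative spectral subspaces of its endpoints. -/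
theorem hasSpectralFlow_relIndex {F : H →L[ℂ] H} (hF : F ∘L F = 1) {γ : ℝ → (H →L[ℂ] H)}
    {α β : ℝ} (hαβ : α < β) (hγ : ContinuousOn γ (Icc α β))
    (hmem : ∀ t ∈ Icc α β, IsSFStar (γ t))
    (hc : ∀ t ∈ Icc α β, IsCompactOperator (γ t - F : H →L[ℂ] H)) :
    HasSpectralFlow γ α β (relIndex (specSub (γ α) 0) (specSub (γ β) 0)) := by
  have hsa : ∀ t ∈ Icc α β, IsSelfAdjoint (γ t) := fun t ht => (hmem t ht).selfAdjoint
  have hcomp : ∀ x ∈ Icc α β, ∀ y ∈ Icc α β, ∀ a ∈ Ioo (-1 : ℝ) 1, ∀ b ∈ Ioo (-1 : ℝ) 1,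
      IsCompactOperator
      ((specSub (γ x) a).starProjection - (specSub (γ y) b).starProjection : H →L[ℂ] H) :=
    fun x hx y hy a ha b hb =>
      specSub_sub_compact hF (hsa x hx) (hc x hx) (hsa y hy) (hc y hy) ha hb
  have h0 : (0 : ℝ) ∈ Ioo (-1 : ℝ) 1 := by norm_num
  refine ⟨hγ, hmem, ?_, ?_⟩
  -- Existence: near each parameter there are gaps just above some level in `(-1,0)` and some level
  -- in `(0,1)`. A Lebesgue number makes an equidistant partition fine enough to use one such pair
  -- per interval.
  · have hloc : ∀ t₀ : Icc α β, ∃ δ > 0, ∃ a a' b b' : ℝ, a ∈ Ioo (-1 : ℝ) 0 ∧ a < a' ∧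
        b ∈ Ioo (0 : ℝ) 1 ∧ b < b' ∧ ∀ t ∈ Metric.ball (t₀ : ℝ) δ ∩ Icc α β,
          specSub (γ t) a = specSub (γ t) a' ∧ specSub (γ t) b = specSub (γ t) b' := by
      intro t₀
      obtain ⟨a, ha, a', ha', h1⟩ := eventually_specSub_eq hF hγ hsa hc t₀.2 (c := -1) (d := 0)
        le_rfl zero_le_one (by norm_num)
      obtain ⟨b, hb, b', hb', h2⟩ := eventually_specSub_eq hF hγ hsa hc t₀.2 (c := 0) (d := 1)
        (by norm_num) le_rfl (by norm_num)
      obtain ⟨δ, hδ, h⟩ := Metric.mem_nhdsWithin_iff.1 (h1.and h2)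
      exact ⟨δ, hδ, a, a', b, b', ha, ha'.1, hb, hb'.1, fun t ht => h ht⟩
    choose δ hδ a a' b b' ha haa' hb hbb' hgap using hloc
    obtain ⟨ε, hε, hleb⟩ := lebesgue_number_lemma_of_metric (s := Icc α β)
      (c := fun t₀ : Icc α β => Metric.ball (t₀ : ℝ) (δ t₀)) isCompact_Icc
      (fun _ => Metric.isOpen_ball)
      (fun t ht => mem_iUnion.2 ⟨⟨t, ht⟩, Metric.mem_ball_self (hδ _)⟩)
    obtain ⟨N, hN⟩ := exists_nat_gt ((β - α) / ε)
    have hβα : 0 < β - α := sub_pos.2 hαβ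
    have hNpos : (0 : ℝ) < N := (by positivity : 0 < (β - α) / ε).trans hN
    have hstep : (β - α) / N < ε := by
      rw [div_lt_iff₀ hNpos]; rwa [div_lt_iff₀ hε, mul_comm] at hN
    let s : ℕ → ℝ := fun n => α + n * ((β - α) / N)
    have hpos : 0 < (β - α) / N := div_pos hβα hNpos
    have hs_succ : ∀ n, s (n + 1) = s n + (β - α) / N := fun n => by
      simp only [s]; push_cast; ring
    have hsN : s N = β := by simp only [s]; field_simp; ring
    have hs_le : ∀ n ≤ N, s n ≤ β := fun n hn => by
      rw [← hsN]
      have : (n : ℝ) ≤ N := by exact_mod_cast hn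
      simp only [s]; gcongr
    have hs_ge : ∀ n, α ≤ s n := fun n => by
      simp only [s]; have : (0 : ℝ) ≤ n * ((β - α) / N) := by positivity
      linarith
    have hsI : ∀ n < N, Icc (s n) (s (n + 1)) ⊆ Icc α β := fun n hn =>
      Icc_subset_Icc (hs_ge n) (hs_le (n + 1) hn)
    have hchoice : ∀ n, ∃ t₀ : Icc α β, n < N →
        Icc (s n) (s (n + 1)) ⊆ Metric.ball (t₀ : ℝ) (δ t₀) := by
      intro n
      by_cases hn : n < N
      · obtain ⟨t₀, ht₀⟩ := hleb (s n) ⟨hs_ge n, hs_le n hn.le⟩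
        refine ⟨t₀, fun _ => Subset.trans ?_ ht₀⟩
        intro t ht
        rw [hs_succ] at ht
        rw [Metric.mem_ball, Real.dist_eq, abs_lt]
        constructor <;> linarith [ht.1, ht.2]
      -- Indices beyond the partition receive an arbitrary parameter.
      · exact ⟨⟨α, left_mem_Icc.2 hαβ.le⟩, fun h => absurd h hn⟩
    choose τ hτ using hchoice
    have hgapn : ∀ n < N, ∀ t ∈ Icc (s n) (s (n + 1)),
        specSub (γ t) (a (τ n)) = specSub (γ t) (a' (τ n)) ∧
        specSub (γ t) (b (τ n)) = specSub (γ t) (b' (τ n)) := fun n hn t ht =>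
      hgap (τ n) t ⟨hτ n hn ht, hsI n hn ht⟩
    have hca : ∀ n < N, ContinuousOn (fun t => specProjIic (γ t) (a (τ n)))
        (Icc (s n) (s (n + 1))) := fun n hn =>
      continuousOn_specProjIic_of_gap (hγ.mono (hsI n hn)) (fun t ht => hsa t (hsI n hn ht))
        (haa' _) (fun t ht => (hgapn n hn t ht).1)
    have hcb : ∀ n < N, ContinuousOn (fun t => specProjIic (γ t) (b (τ n)))
        (Icc (s n) (s (n + 1))) := fun n hn =>
      continuousOn_specProjIic_of_gap (hγ.mono (hsI n hn)) (fun t ht => hsa t (hsI n hn ht))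
        (hbb' _) (fun t ht => (hgapn n hn t ht).2)
    have hA : ∀ n, a (τ n) ∈ Ioo (-1 : ℝ) 1 := fun n =>
      ⟨(ha (τ n)).1, (ha (τ n)).2.trans zero_lt_one⟩
    have hB : ∀ n, b (τ n) ∈ Ioo (-1 : ℝ) 1 := fun n =>
      ⟨neg_one_lt_zero.trans (hb (τ n)).1, (hb (τ n)).2⟩
    have hAB : ∀ n, a (τ n) ≤ b (τ n) := fun n => ((ha (τ n)).2.trans (hb (τ n)).1).le
    refine ⟨N, s, fun n => a (τ n), fun n => b (τ n),
      { left := by simp [s]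
        right := hsN
        lt := fun n _ => by rw [hs_succ]; linarith
        lower := fun n _ => ha (τ n)
        upper := fun n _ => hb (τ n)
        cont := fun n hn => (hcb n hn).sub (hca n hn)
        finite := fun n hn t ht => ?_
        rank := fun n hn t ht t' ht' => ?_ }⟩
    · rw [specProj_range (hAB n)]
      exact finiteDimensional_inf_orthogonal
        (hcomp t (hsI n hn ht) t (hsI n hn ht) _ (hB n) _ (hA n))
    · have i := hsI n hn ht
      have i' := hsI n hn ht'
      have z1 := relIndex_eq_zero_of_continuousOn hF isPreconnected_Icc
        (fun t ht => hsa t (hsI n hn ht)) (fun t ht => hc t (hsI n hn ht)) (hB n) (hcb n hn) ht ht'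
      have z2 := relIndex_eq_zero_of_continuousOn hF isPreconnected_Icc
        (fun t ht => hsa t (hsI n hn ht)) (fun t ht => hc t (hsI n hn ht)) (hA n) (hca n hn) ht ht'
      have y1 := relIndex_add (hcomp t i t i _ (hB n) _ (hA n)) (hcomp t i t' i' _ (hA n) _ (hA n))
      have y2 := relIndex_add (hcomp t i t' i' _ (hB n) _ (hB n))
        (hcomp t' i' t' i' _ (hB n) _ (hA n))
      have w := finrank_specProj_range (F := γ t) (hAB n)
      have w' := finrank_specProj_range (F := γ t') (hAB n)
      omega
  · intro N s a b hp
    have hmono : ∀ m n, m ≤ n → n ≤ N → s m ≤ s n := by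
      intro m n hmn
      induction n, hmn using Nat.le_induction with
      | base => exact fun _ => le_rfl
      | succ k _ ih => exact fun hk => (ih (by omega)).trans (hp.lt k hk).le
    have hI : ∀ n ≤ N, s n ∈ Icc α β := fun n hn =>
      ⟨hp.left ▸ hmono 0 n (Nat.zero_le n) hn, hp.right ▸ hmono n N hn le_rfl⟩
    -- Write `E_c(t)` for `specSub (γ t) c`. The dimensions are relative indices of `E_0` and `E_{a
    -- n}` at the same parameter, and `E_{a n}` has relative index zero between the ends of the
    -- interval. The summand is thus the index of `E_0(s n)` relative to `E_0(s (n+1))`; measuring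
    -- from `s 0` makes the sum telescope, whatever the levels.
    have hterm : ∀ n ∈ Finset.range N,
        ((finrank ℂ (specProj (γ (s n)) (a n) 0).range : ℤ) -
          (finrank ℂ (specProj (γ (s (n + 1))) (a n) 0).range : ℤ)) =
        relIndex (specSub (γ (s 0)) 0) (specSub (γ (s (n + 1))) 0) -
          relIndex (specSub (γ (s 0)) 0) (specSub (γ (s n)) 0) := by
      intro n hn
      have hn : n < N := Finset.mem_range.1 hn
      have i0 := hI 0 (Nat.zero_le N)
      have i := hI n hn.le
      have i' := hI (n + 1) hn
      have hsub : Icc (s n) (s (n + 1)) ⊆ Icc α β := Icc_subset_Icc i.1 i'.2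
      have hla := hp.lower n hn
      have hA : a n ∈ Ioo (-1 : ℝ) 1 := ⟨hla.1, hla.2.trans zero_lt_one⟩
      have hcont := continuousOn_specProjIic (hγ.mono hsub) (fun t ht => hsa t (hsub ht))
        (hla.2.trans (hp.upper n hn).1) (hp.cont n hn)
      have z := relIndex_eq_zero_of_continuousOn hF isPreconnected_Icc
        (fun t ht => hsa t (hsub ht)) (fun t ht => hc t (hsub ht)) hA hcont
        (left_mem_Icc.2 (hp.lt n hn).le) (right_mem_Icc.2 (hp.lt n hn).le)
      have y1 := relIndex_add (hcomp _ i0 _ i 0 h0 0 h0) (hcomp _ i _ i 0 h0 _ hA)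
      have y2 := relIndex_add (hcomp _ i0 _ i' 0 h0 0 h0) (hcomp _ i' _ i' 0 h0 _ hA)
      have y3 := relIndex_add (hcomp _ i0 _ i 0 h0 _ hA) (hcomp _ i _ i' _ hA _ hA)
      have w := finrank_specProj_range (F := γ (s n)) hla.2.le
      have w' := finrank_specProj_range (F := γ (s (n + 1))) hla.2.le
      omega
    rw [flowSum, Finset.sum_congr rfl hterm,
      Finset.sum_range_sub (fun n => relIndex (specSub (γ (s 0)) 0) (specSub (γ (s n)) 0)),
      hp.left, hp.right]
    simp [relIndex]

end Flow

/-! ### Antiunitary symmetry and Kramers degeneracy -/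

section Parity

/-- In a basis `W` has a matrix `A` with `A Ā = -1`; taking determinants, `|det A|² = (-1)^n`, which
rules out odd `n`. -/
theorem even_finrank_of_antilinear {S : Type*} [AddCommGroup S] [Module ℂ S]
    (W : S → S) (hadd : ∀ x y, W (x + y) = W x + W y)
    (hsmul : ∀ (c : ℂ) x, W (c • x) = (starRingEnd ℂ) c • W x) (hsq : ∀ x, W (W x) = -x) :
    Even (finrank ℂ S) := by
  by_cases hfd : FiniteDimensional ℂ S
  swap
  -- In infinite dimension `finrank` is zero by convention, hence even.
  · rw [finrank_of_infinite_dimensional hfd]; exact Even.zero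
  let b := finBasis ℂ S
  let L : S →ₛₗ[starRingEnd ℂ] S := { toFun := W, map_add' := hadd, map_smul' := hsmul }
  let A : Matrix (Fin (finrank ℂ S)) (Fin (finrank ℂ S)) ℂ := fun i j => b.repr (W (b j)) i
  have hW : ∀ j, W (b j) = ∑ i, A i j • b i := fun j => (b.sum_repr (W (b j))).symm
  have hA : A * A.map (starRingEnd ℂ) = -1 := by
    ext k j
    have h1 : W (W (b j)) = ∑ i, (starRingEnd ℂ) (A i j) • W (b i) := by
      rw [hW j]
      change L (∑ i, A i j • b i) = _
      rw [map_sum]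
      exact Finset.sum_congr rfl fun i _ => hsmul _ _
    have h2 : b.repr (W (W (b j))) k = ∑ i, (starRingEnd ℂ) (A i j) * A k i := by
      rw [h1, map_sum, Finsupp.finsetSum_apply]
      simp [A]
    rw [hsq] at h2
    rw [Matrix.mul_apply, Matrix.neg_apply, Matrix.one_apply]
    simp only [Matrix.map_apply]
    rw [show (∑ i, A k i * (starRingEnd ℂ) (A i j)) = ∑ i, (starRingEnd ℂ) (A i j) * A k i from
      Finset.sum_congr rfl fun i _ => mul_comm _ _, ← h2]
    simp [Finsupp.single_apply, eq_comm]
  have hdet := congrArg Matrix.det hA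
  rw [Matrix.det_mul, Matrix.det_neg, Matrix.det_one, mul_one] at hdet
  have hd : (A.map (starRingEnd ℂ)).det = (starRingEnd ℂ) A.det :=
    (RingHom.map_det (starRingEnd ℂ) A).symm
  rw [hd, Complex.mul_conj, Fintype.card_fin] at hdet
  rcases Nat.even_or_odd (finrank ℂ S) with h | h
  · exact h
  · rw [h.neg_one_pow] at hdet
    have h1 : (Complex.normSq A.det : ℂ).re = (-1 : ℂ).re := by rw [hdet]
    have h2 := Complex.normSq_nonneg A.det
    simp at h1
    linarith

variable {H : Type*} [NormedAddCommGroup H] [InnerProductSpace ℂ H]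

/-- Polarization: the norm is preserved, and antilinearity flips the sign of the two terms
containing `i`. -/
theorem Conjugation.inner_map_map (C : Conjugation H) (x y : H) :
    inner ℂ (C.toEquiv x) (C.toEquiv y) = inner ℂ y x := by
  have hn : ∀ z, ‖C.toEquiv z‖ = ‖z‖ := C.toEquiv.norm_map
  have hs : ∀ (c : ℂ) z, C.toEquiv (c • z) = (starRingEnd ℂ) c • C.toEquiv z := fun c z =>
    C.toEquiv.map_smulₛₗ c z
  have hi : ∀ z, Complex.I • C.toEquiv z = C.toEquiv (-(Complex.I • z)) := fun z => by
    rw [← neg_smul, hs]; simp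
  rw [inner_eq_sum_norm_sq_div_four, inner_eq_sum_norm_sq_div_four (𝕜 := ℂ) y x]
  simp only [RCLike.I_to_complex]
  rw [hi, ← map_add, ← map_sub, ← map_add, ← map_sub, hn, hn, hn, hn]
  have e1 : ‖x + -(Complex.I • y)‖ = ‖y + Complex.I • x‖ := by
    have : y + Complex.I • x = Complex.I • (x + -(Complex.I • y)) := by
      rw [smul_add, smul_neg, smul_smul, Complex.I_mul_I]; simp [add_comm]
    rw [this, norm_smul, Complex.norm_I, one_mul]
  have e2 : ‖x - -(Complex.I • y)‖ = ‖y - Complex.I • x‖ := by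
    have : y - Complex.I • x = -(Complex.I • (x - -(Complex.I • y))) := by
      rw [smul_sub, smul_neg, smul_smul, Complex.I_mul_I]; simp
    rw [this, norm_neg, norm_smul, Complex.norm_I, one_mul]
  rw [e1, e2, add_comm x y, norm_sub_rev x y]

theorem conjOp_apply (C : Conjugation H) (T : H →L[ℂ] H) (x : H) :
    conjOp C T x = C.toEquiv (T (C.toEquiv x)) := rfl

theorem conjOp_comp (C : Conjugation H) (S T : H →L[ℂ] H) :
    conjOp C (S ∘L T) = conjOp C S ∘L conjOp C T := by
  ext x
  simp only [conjOp_apply, comp_apply, C.involutive]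

variable [CompleteSpace H]

theorem adjoint_conjOp (C : Conjugation H) (T : H →L[ℂ] H) :
    adjoint (conjOp C T) = conjOp C (adjoint T) := by
  symm
  rw [eq_adjoint_iff]
  intro x y
  rw [conjOp_apply, conjOp_apply]
  nth_rw 1 [← C.involutive y]
  nth_rw 2 [← C.involutive x]
  rw [C.inner_map_map, C.inner_map_map, adjoint_inner_right]

/-- Conjugation by the antiunitary operator `C J`, as a real star algebra homomorphism. -/
def conjStarHom (C : Conjugation H) (J : H →L[ℂ] H) (hJ : J ∈ unitary (H →L[ℂ] H)) :
    (H →L[ℂ] H) →⋆ₐ[ℝ] (H →L[ℂ] H) where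
  toFun A := adjoint J ∘L conjOp C A ∘L J
  map_one' := by
    ext x
    have : adjoint J (J x) = x := congrArg (fun A : H →L[ℂ] H => A x) hJ.1
    simp [conjOp_apply, C.involutive, this]
  map_mul' A B := by
    have h : J ∘L adjoint J = 1 := hJ.2
    change adjoint J ∘L conjOp C (A ∘L B) ∘L J =
      (adjoint J ∘L conjOp C A ∘L J) ∘L (adjoint J ∘L conjOp C B ∘L J)
    rw [conjOp_comp]
    ext x
    have h' : ∀ y, J (adjoint J y) = y := fun y => congrArg (fun A : H →L[ℂ] H => A y) h
    simp only [comp_apply, h']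
  map_zero' := by
    ext x
    simp [conjOp_apply]
  map_add' A B := by
    ext x
    simp [conjOp_apply]
  commutes' r := by
    ext x
    have : adjoint J (J x) = x := congrArg (fun A : H →L[ℂ] H => A x) hJ.1
    have h2 : ∀ y : H, C.toEquiv (r • y) = r • C.toEquiv y := fun y => by
      have := C.toEquiv.map_smulₛₗ (r : ℂ) y
      rwa [Complex.conj_ofReal, Complex.coe_smul, Complex.coe_smul] at this
    have h3 : ∀ y : H, adjoint J (r • y) = r • adjoint J y := fun y => by
      rw [← Complex.coe_smul, map_smul, Complex.coe_smul]
    simp [conjOp_apply, C.involutive, Algebra.algebraMap_eq_smul_one, h2, h3, this]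
  map_star' A := by
    simp only [star_eq_adjoint, adjoint_comp, adjoint_adjoint, adjoint_conjOp, comp_assoc]

theorem continuous_conjStarHom (C : Conjugation H) (J : H →L[ℂ] H)
    (hJ : J ∈ unitary (H →L[ℂ] H)) : Continuous (conjStarHom C J hJ) := by
  refine AddMonoidHomClass.continuous_of_bound (conjStarHom C J hJ)
    (‖adjoint J‖ * ‖J‖) fun A => ?_
  refine opNorm_le_bound _ (by positivity) fun x => ?_
  change ‖adjoint J (C.toEquiv (A (C.toEquiv (J x))))‖ ≤ _
  calc _ ≤ ‖adjoint J‖ * ‖C.toEquiv (A (C.toEquiv (J x)))‖ := le_opNorm _ _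
    _ ≤ ‖adjoint J‖ * (‖A‖ * (‖J‖ * ‖x‖)) := by
      rw [C.toEquiv.norm_map]
      gcongr
      refine (le_opNorm _ _).trans ?_
      rw [C.toEquiv.norm_map]
      gcongr
      exact le_opNorm _ _
    _ = _ := by ring

/-- Conjugation by the antiunitary `C J` is a continuous real star homomorphism, so it commutes with
the real functional calculus: if it fixes `G` it fixes `(G - c)₊`, whose kernel is therefore
invariant. -/
theorem antiunitary_mem_specSub {C : Conjugation H} {J : H →L[ℂ] H}
    (hJ : J ∈ unitary (H →L[ℂ] H)) {G : H →L[ℂ] H} (hG : IsSelfAdjoint G)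
    (h : adjoint J ∘L conjOp C G ∘L J = G) {c : ℝ} {x : H} (hx : x ∈ specSub G c) :
    C.toEquiv (J x) ∈ specSub G c := by
  have h1 : conjStarHom C J hJ G = G := h
  have h2 : conjStarHom C J hJ (cfc (fun x : ℝ => max (x - c) 0) G)
      = cfc (fun x : ℝ => max (x - c) 0) G := by
    have := StarAlgHom.map_cfc (conjStarHom C J hJ) (fun x : ℝ => max (x - c) 0) G
      (by fun_prop) (continuous_conjStarHom C J hJ) hG (by rw [h1]; exact hG)
    rwa [h1] at this
  rw [mem_specSub] at hx ⊢
  set A := cfc (fun x : ℝ => max (x - c) 0) G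
  have h3 : adjoint J (C.toEquiv (A (C.toEquiv (J x)))) = A x :=
    congrArg (fun B : H →L[ℂ] H => B x) h2
  have h4 : ∀ y, J (adjoint J y) = y := fun y => congrArg (fun B : H →L[ℂ] H => B y) hJ.2
  have h5 := congrArg J h3
  rw [h4, hx, map_zero] at h5
  exact (map_eq_zero_iff C.toEquiv C.toEquiv.injective).1 h5

/-- Subspaces invariant under an antiunitary operator of square `-1` have even relative index. -/
theorem even_relIndex {C : Conjugation H} {J : H →L[ℂ] H} (hJ : J ∈ unitary (H →L[ℂ] H))
    (hsq : ∀ x, C.toEquiv (J (C.toEquiv (J x))) = -x) {M N : Submodule ℂ H}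
    (hM : ∀ x ∈ M, C.toEquiv (J x) ∈ M) (hN : ∀ x ∈ N, C.toEquiv (J x) ∈ N) :
    Even (relIndex M N) := by
  have horth : ∀ S : Submodule ℂ H, (∀ x ∈ S, C.toEquiv (J x) ∈ S) →
      ∀ x ∈ Sᗮ, C.toEquiv (J x) ∈ Sᗮ := by
    intro S hS x hx y hy
    -- From `W² = -1` every `y` equals `W(-W y)`, so antiunitarity moves `W` off the other vector in
    -- the inner product.
    have h1 : y = C.toEquiv (J (-(C.toEquiv (J y)))) := by
      rw [map_neg, map_neg, hsq, neg_neg]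
    rw [h1, C.inner_map_map, ← adjoint_inner_right,
      show adjoint J (J (-(C.toEquiv (J y)))) = -(C.toEquiv (J y)) from
        congrArg (fun B : H →L[ℂ] H => B _) hJ.1]
    exact Submodule.inner_left_of_mem_orthogonal (Submodule.neg_mem _ (hS y hy)) hx
  have heven : ∀ S : Submodule ℂ H, (∀ x ∈ S, C.toEquiv (J x) ∈ S) →
      Even (finrank ℂ S) := fun S hS =>
    even_finrank_of_antilinear (fun x : S => ⟨C.toEquiv (J x), hS x x.2⟩)
      (fun x y => Subtype.ext (by simp)) (fun c x => Subtype.ext (by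
        change C.toEquiv (J (c • (x : H))) = _
        rw [map_smul]
        exact C.toEquiv.map_smulₛₗ _ _))
      (fun x => Subtype.ext (hsq x))
  have h1 := heven (M ⊓ Nᗮ) fun x hx => ⟨hM x hx.1, horth N hN x hx.2⟩
  have h2 := heven (N ⊓ Mᗮ) fun x hx => ⟨hN x hx.1, horth M hM x hx.2⟩
  exact ((Int.even_coe_nat _).2 h1).sub ((Int.even_coe_nat _).2 h2)

end Parity

/-! ### Quadratic forms and the nonpositive spectral subspace -/

section Forms

variable {H : Type*} [NormedAddCommGroup H] [InnerProductSpace ℂ H] [CompleteSpace H]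

theorem inner_cfc_sq {G : H →L[ℂ] H} {f g : ℝ → ℝ} (hf : Continuous f)
    (e : ∀ x, f x * f x = g x) (x : H) :
    inner ℂ x (cfc g G x) = ((‖cfc f G x‖ ^ 2 : ℝ) : ℂ) := by
  rw [← cfc_apply_apply hf hf e, ← inner_cfc_left, inner_self_eq_norm_sq_to_K]
  norm_cast

theorem mem_specSub_zero_iff {G : H →L[ℂ] H} {x : H} :
    x ∈ specSub G 0 ↔ cfc (fun t : ℝ => √(max (t - 0) 0)) G x = 0 := by
  have e : ∀ t : ℝ, √(max (t - 0) 0) * √(max (t - 0) 0) = max (t - 0) 0 := fun t =>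
    Real.mul_self_sqrt (le_max_right _ _)
  have c : Continuous (fun t : ℝ => √(max (t - 0) 0)) := by fun_prop
  rw [mem_specSub]
  constructor
  · intro h
    have := inner_cfc_sq (G := G) c e x
    rw [h, inner_zero_right] at this
    have h2 : ‖cfc (fun t : ℝ => √(max (t - 0) 0)) G x‖ ^ 2 = 0 := by exact_mod_cast this.symm
    exact norm_eq_zero.1 (pow_eq_zero_iff two_ne_zero |>.1 h2)
  · intro h
    rw [← cfc_apply_apply c c e, h, map_zero]

theorem re_inner_apply_self {G : H →L[ℂ] H} (hG : IsSelfAdjoint G) (x : H) :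
    (inner ℂ x (G x)).re = ‖cfc (fun t : ℝ => √(max (t - 0) 0)) G x‖ ^ 2 -
      ‖cfc (fun t : ℝ => √(max (0 - t) 0)) G x‖ ^ 2 := by
  have h1 := inner_cfc_sq (G := G) (f := fun t : ℝ => √(max (t - 0) 0)) (by fun_prop)
    (fun t => Real.mul_self_sqrt (le_max_right (t - 0) 0)) x
  have h2 := inner_cfc_sq (G := G) (f := fun t : ℝ => √(max (0 - t) 0)) (by fun_prop)
    (fun t => Real.mul_self_sqrt (le_max_right (0 - t) 0)) x
  have h3 : G = cfc (fun t : ℝ => max (t - 0) 0) G - cfc (fun t : ℝ => max (0 - t) 0) G := by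
    rw [← cfc_sub _ _ G (by fun_prop) (by fun_prop)]
    conv_lhs => rw [← cfc_id' ℝ G]
    congr 1
    funext t
    rcases le_total t 0 with h | h
    · rw [max_eq_right (by linarith), max_eq_left (by linarith)]; ring
    · rw [max_eq_left (by linarith), max_eq_right (by linarith)]; ring
  have h4 : G x = cfc (fun t : ℝ => max (t - 0) 0) G x - cfc (fun t : ℝ => max (0 - t) 0) G x :=
    congrArg (fun A : H →L[ℂ] H => A x) h3
  rw [h4, inner_sub_right, h1, h2, ← Complex.ofReal_sub, Complex.ofReal_re]

theorem re_inner_nonpos_of_mem {G : H →L[ℂ] H} (hG : IsSelfAdjoint G) {x : H}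
    (hx : x ∈ specSub G 0) : (inner ℂ x (G x)).re ≤ 0 := by
  rw [re_inner_apply_self hG, mem_specSub_zero_iff.1 hx, norm_zero]
  have := sq_nonneg ‖cfc (fun t : ℝ => √(max (0 - t) 0)) G x‖
  linarith

/-- The range of `G₋` lies in `specSub G 0`, so the negative part of the form vanishes at `x`. A
nonpositive form then kills the positive part too, placing `x` in `specSub G 0` as well as in its
complement. -/
theorem eq_zero_of_mem_orthogonal {G : H →L[ℂ] H} (hG : IsSelfAdjoint G) {x : H}
    (hx : x ∈ (specSub G 0)ᗮ) (h : (inner ℂ x (G x)).re ≤ 0) : x = 0 := by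
  have h1 : cfc (fun t : ℝ => max (0 - t) 0) G x ∈ specSub G 0 := by
    rw [mem_specSub, cfc_apply_apply (h := fun _ => 0) (by fun_prop) (by fun_prop),
      cfc_const_zero]
    · rfl
    · intro t
      rcases le_total t 0 with h | h
      · rw [max_eq_right (by linarith), zero_mul]
      · rw [max_eq_right (a := 0 - t) (by linarith), mul_zero]
  have h2 := inner_cfc_sq (G := G) (f := fun t : ℝ => √(max (0 - t) 0)) (by fun_prop)
    (fun t => Real.mul_self_sqrt (le_max_right (0 - t) 0)) x
  rw [Submodule.inner_left_of_mem_orthogonal h1 hx] at h2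
  have h3 : ‖cfc (fun t : ℝ => √(max (0 - t) 0)) G x‖ ^ 2 = 0 := by exact_mod_cast h2.symm
  rw [re_inner_apply_self hG, h3, sub_zero] at h
  have h4 : x ∈ specSub G 0 := by
    rw [mem_specSub_zero_iff, ← norm_eq_zero]
    exact pow_eq_zero_iff two_ne_zero |>.1 (le_antisymm h (sq_nonneg _))
  exact inner_self_eq_zero.1 (hx x h4)

theorem cfc_apply_comm {G : H →L[ℂ] H} (hG : IsSelfAdjoint G) {f : ℝ → ℝ} (hf : Continuous f)
    (x : H) : cfc f G (G x) = G (cfc f G x) := by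
  have h1 := cfc_apply_apply (F := G) (g := fun t => t) hf continuous_id (fun t => rfl) x
  have h2 := cfc_apply_apply (F := G) (f := fun t => t) continuous_id hf
    (fun t => mul_comm t (f t)) x
  rw [cfc_id' ℝ G] at h1 h2
  rw [h1, h2]

/-- The vector `y = √G₊ x` again satisfies `Gy = ly`, while `√G₋ y = 0`. Thus `‖√G₊ y‖² = l‖y‖² ≤
0`, and `‖y‖² = ⟨x, √G₊ y⟩ = 0`. -/
theorem mem_specSub_zero_of_apply_eq {G : H →L[ℂ] H} (hG : IsSelfAdjoint G) {x : H} {l : ℝ}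
    (hl : l ≤ 0) (h : G x = l • x) : x ∈ specSub G 0 := by
  rw [mem_specSub_zero_iff]
  set y := cfc (fun t : ℝ => √(max (t - 0) 0)) G x with hy
  have c : Continuous (fun t : ℝ => √(max (t - 0) 0)) := by fun_prop
  have h1 : G y = l • y := by
    rw [hy, ← cfc_apply_comm hG c, h, ← Complex.coe_smul, map_smul, Complex.coe_smul]
  have h2 := re_inner_apply_self hG y
  have h3 : cfc (fun t : ℝ => √(max (0 - t) 0)) G y = 0 := by
    rw [hy, cfc_apply_apply (h := fun _ => 0) (by fun_prop) c, cfc_const_zero]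
    · rfl
    · intro t
      rcases le_total t 0 with h | h
      · rw [max_eq_right (a := t - 0) (by linarith), Real.sqrt_zero, mul_zero]
      · rw [max_eq_right (a := 0 - t) (by linarith), Real.sqrt_zero, zero_mul]
  have h4 : (inner ℂ y (G y)).re = l * ‖y‖ ^ 2 := by
    rw [h1, ← Complex.coe_smul, inner_smul_right, inner_self_eq_norm_sq_to_K,
      Complex.re_ofReal_mul]
    norm_cast
  rw [h3, norm_zero, h4] at h2
  have h5 : ‖cfc (fun t : ℝ => √(max (t - 0) 0)) G y‖ ^ 2 = 0 := by
    have := sq_nonneg ‖cfc (fun t : ℝ => √(max (t - 0) 0)) G y‖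
    have := mul_nonpos_of_nonpos_of_nonneg hl (sq_nonneg ‖y‖)
    linarith
  have h6 : cfc (fun t : ℝ => √(max (t - 0) 0)) G y = 0 :=
    norm_eq_zero.1 (pow_eq_zero_iff two_ne_zero |>.1 h5)
  rw [← inner_self_eq_zero (𝕜 := ℂ)]
  nth_rw 1 [hy]
  rw [inner_cfc_left, h6, inner_zero_right]

theorem mem_specSub_symmetry {F : H →L[ℂ] H} (hF : IsSelfAdjoint F) (hFF : F ∘L F = 1) {x : H} :
    x ∈ specSub F 0 ↔ F x = -x := by
  have hF' : ∀ x, F (F x) = x := fun x => congrArg (fun A : H →L[ℂ] H => A x) hFF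
  constructor
  · intro hx
    -- The vector `Fx + x` stays in the nonpositive subspace but is fixed by `F`, so its form value
    -- is its squared norm.
    have h1 : F x + x ∈ specSub F 0 := by
      rw [mem_specSub, map_add, cfc_apply_comm hF (by fun_prop), mem_specSub.1 hx, map_zero,
        add_zero]
    have h2 := re_inner_nonpos_of_mem hF h1
    have h3 : F (F x + x) = F x + x := by rw [map_add, hF', add_comm]
    rw [h3] at h2
    have h4 : F x + x = 0 := by
      have h5 := inner_self_eq_norm_sq (𝕜 := ℂ) (F x + x)
      rw [RCLike.re_to_complex] at h5
      rw [h5] at h2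
      exact norm_eq_zero.1 (pow_eq_zero_iff two_ne_zero |>.1 (le_antisymm h2 (sq_nonneg _)))
    exact eq_neg_of_add_eq_zero_left h4
  · intro hx
    exact mem_specSub_zero_of_apply_eq hF (l := -1) (by norm_num) (by rw [hx]; simp)

theorem mem_specSub_orthogonal_symmetry {F : H →L[ℂ] H} (hF : IsSelfAdjoint F)
    (hFF : F ∘L F = 1) {x : H} : x ∈ (specSub F 0)ᗮ ↔ F x = x := by
  have hF' : ∀ x, F (F x) = x := fun x => congrArg (fun A : H →L[ℂ] H => A x) hFF
  have hin : ∀ x y, inner ℂ (F x) y = inner ℂ x (F y) := fun x y => by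
    rw [← adjoint_inner_right, hF.adjoint_eq]
  constructor
  · intro hx
    have h1 : x - F x ∈ specSub F 0 := by
      rw [mem_specSub_symmetry hF hFF, map_sub, hF', neg_sub]
    have h2 := hx _ h1
    have h3 : inner ℂ (x - F x) (F x) = 0 := by
      rw [← hin, map_sub, hF', ← neg_sub x, inner_neg_left, h2, neg_zero]
    have h4 : inner ℂ (x - F x) (x - F x) = (0 : ℂ) := by rw [inner_sub_right, h2, h3, sub_zero]
    exact (sub_eq_zero.1 (inner_self_eq_zero.1 h4)).symm
  · intro hx y hy
    rw [mem_specSub_symmetry hF hFF] at hy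
    have h1 := hin y x
    rw [hx, hy, inner_neg_left] at h1
    exact self_eq_neg.1 h1.symm

end Forms

/-! ### Compactness of adjoints and the symmetry `2ΠΠ* - 1` -/

section Dilation

variable {K H : Type*} [NormedAddCommGroup K] [InnerProductSpace ℂ K] [CompleteSpace K]
  [NormedAddCommGroup H] [InnerProductSpace ℂ H] [CompleteSpace H]

/-- The estimate `‖Ax‖² ≤ ‖A*Ax‖ ‖x‖` carries total boundedness of the image of the unit ball from
`A*A` to `A`. -/
theorem isCompactOperator_of_adjoint_comp {A : K →L[ℂ] H}
    (h : IsCompactOperator (adjoint A ∘L A : K →L[ℂ] K)) : IsCompactOperator A := by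
  have hest : ∀ x, ‖A x‖ ^ 2 ≤ ‖(adjoint A ∘L A) x‖ * ‖x‖ := by
    intro x
    have h1 : inner ℂ ((adjoint A ∘L A) x) x = ((‖A x‖ ^ 2 : ℝ) : ℂ) := by
      rw [comp_apply, adjoint_inner_left, inner_self_eq_norm_sq_to_K]; norm_cast
    have h2 := norm_inner_le_norm (𝕜 := ℂ) ((adjoint A ∘L A) x) x
    rw [h1, Complex.norm_real, Real.norm_of_nonneg (sq_nonneg _)] at h2
    exact h2
  refine (isCompactOperator_iff_isCompact_closure_image_closedBall (𝕜₁ := ℂ) (A : K →ₗ[ℂ] H)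
    one_pos).2 ?_
  have htb : TotallyBounded ((adjoint A ∘L A) '' Metric.closedBall 0 1) := by
    obtain ⟨S, hS, hsub⟩ := h.image_closedBall_subset_compact
      (f := ((adjoint A ∘L A : K →L[ℂ] K) : K →ₗ[ℂ] K)) 1
    exact hS.totallyBounded.subset hsub
  refine isCompact_iff_totallyBounded_isComplete.2 ⟨TotallyBounded.closure ?_,
    isClosed_closure.isComplete⟩
  rw [Metric.totallyBounded_iff]
  intro ε hε
  -- Two points of the unit ball are at distance at most 2, so a net of mesh `ε²/4` yields squared
  -- distance below `ε²/2`.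
  obtain ⟨t, hts, htf, hcov⟩ := Metric.finite_approx_of_totallyBounded htb (ε ^ 2 / 4)
    (by positivity)
  choose! p hp hpe using fun y (hy : y ∈ t) => hts hy
  refine ⟨(fun y => A (p y)) '' t, htf.image _, ?_⟩
  rintro _ ⟨x, hx, rfl⟩
  obtain ⟨y, hy, hxy⟩ := mem_iUnion₂.1 (hcov ⟨x, hx, rfl⟩)
  refine mem_iUnion₂.2 ⟨A (p y), ⟨y, hy, rfl⟩, ?_⟩
  rw [Metric.mem_ball, dist_eq_norm] at hxy ⊢
  rw [← hpe y hy, ← map_sub] at hxy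
  change ‖A x - A (p y)‖ < ε
  rw [← map_sub]
  have h1 := hest (x - p y)
  have h2 : ‖x - p y‖ ≤ 2 := by
    have a := mem_closedBall_zero_iff.1 hx
    have b := mem_closedBall_zero_iff.1 (hp y hy)
    linarith [norm_sub_le x (p y)]
  have h3 : ‖A (x - p y)‖ ^ 2 < ε ^ 2 := by
    have := mul_le_mul hxy.le h2 (norm_nonneg _) (by positivity)
    have h5 : 0 < ε ^ 2 := by positivity
    linarith
  exact lt_of_pow_lt_pow_left₀ 2 hε.le h3

theorem isCompactOperator_adjoint {A : K →L[ℂ] H} (h : IsCompactOperator A) :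
    IsCompactOperator (adjoint A) := by
  refine isCompactOperator_of_adjoint_comp ?_
  rw [adjoint_adjoint]
  exact isCompactOperator_comp_right h (adjoint A)

variable (V : K →ₗᵢ[ℂ] H)

theorem adjoint_isometry_apply (y : K) : adjoint V.toContinuousLinearMap (V y) = y := by
  refine ext_inner_left ℂ fun z => ?_
  rw [adjoint_inner_right]
  exact V.inner_map_map z y

theorem dilationF_apply (x : H) :
    dilationF V x = (2 : ℂ) • V (adjoint V.toContinuousLinearMap x) - x := rfl

theorem dilationF_comp_self : dilationF V ∘L dilationF V = 1 := by
  ext x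
  rw [comp_apply, dilationF_apply, dilationF_apply, map_sub, map_smul, adjoint_isometry_apply,
    clm_one_apply, map_sub, map_smul]
  module

theorem isSelfAdjoint_dilationF : IsSelfAdjoint (dilationF V) := by
  have h1 : IsSelfAdjoint (V.toContinuousLinearMap ∘L adjoint V.toContinuousLinearMap) := by
    rw [isSelfAdjoint_iff', adjoint_comp, adjoint_adjoint]
  have h2 : IsSelfAdjoint (2 : ℂ) := by
    rw [isSelfAdjoint_iff]; simp
  exact (h2.smul h1).sub (IsSelfAdjoint.one _)

theorem dilationF_map (y : K) : dilationF V (V y) = V y := by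
  rw [dilationF_apply, adjoint_isometry_apply]; module

theorem norm_dilationF_le : ‖dilationF V‖ ≤ 1 := by
  have h := CStarRing.norm_self_mul_star (x := dilationF V)
  rw [(isSelfAdjoint_dilationF V).star_eq] at h
  have h2 : dilationF V * dilationF V = 1 := dilationF_comp_self V
  rw [h2] at h
  have h3 : ‖(1 : H →L[ℂ] H)‖ ≤ 1 := ContinuousLinearMap.norm_id_le
  nlinarith [norm_nonneg (dilationF V)]

theorem re_inner_dilationF (x : H) : (inner ℂ x (dilationF V x)).re =
    2 * ‖adjoint V.toContinuousLinearMap x‖ ^ 2 - ‖x‖ ^ 2 := by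
  have h : inner ℂ x (V (adjoint V.toContinuousLinearMap x)) =
      ((‖adjoint V.toContinuousLinearMap x‖ ^ 2 : ℝ) : ℂ) := by
    have := adjoint_inner_left V.toContinuousLinearMap (adjoint V.toContinuousLinearMap x) x
    rw [inner_self_eq_norm_sq_to_K] at this
    rw [LinearIsometry.coe_toContinuousLinearMap] at this
    rw [← this]; norm_cast
  rw [dilationF_apply, inner_sub_right, inner_smul_right, h, inner_self_eq_norm_sq_to_K]
  norm_cast

/-- Compact perturbations do not change the essential spectrum. For `F` itself, `(F - z)(F + z) = 1
- z²` gives an inverse when `z ≠ ±1`, and the eigenspaces for `1` and `-1` contain the range of `Π`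
and its complement, both infinite dimensional. -/
theorem essSpectrum_eq_of_compact {G : H →L[ℂ] H} (hK : ¬ FiniteDimensional ℂ K)
    (hK' : ¬ FiniteDimensional ℂ (V.toContinuousLinearMap.rangeᗮ : Submodule ℂ H))
    (hc : IsCompactOperator (G - dilationF V : H →L[ℂ] H)) : essSpectrum G = {-1, 1} := by
  have h1 : ∀ z : ℂ, IsFredholm (G - z • (1 : H →L[ℂ] H)) ↔
      IsFredholm (dilationF V - z • (1 : H →L[ℂ] H)) := fun z => by
    constructor
    · intro h
      refine isFredholm_of_sub_compact h ?_
      rw [sub_sub_sub_cancel_right]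
      exact isCompactOperator_sub_comm hc
    · intro h
      refine isFredholm_of_sub_compact h ?_
      rwa [sub_sub_sub_cancel_right]
  ext z
  simp only [essSpectrum, mem_ofPred_eq, h1, mem_insert_iff, mem_singleton_iff]
  constructor
  · intro h
    by_contra hz
    push Not at hz
    have hz2 : 1 - z * z ≠ 0 := by
      intro h0
      have : (1 - z) * (1 + z) = 0 := by linear_combination h0
      rcases mul_eq_zero.1 this with h | h
      · exact hz.2 (by linear_combination -h)
      · exact hz.1 (by linear_combination h)
    have hF' : ∀ x, dilationF V (dilationF V x) = x := fun x =>
      congrArg (fun A : H →L[ℂ] H => A x) (dilationF_comp_self V)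
    refine h (isFredholm_of_compact
      (S := (1 - z * z)⁻¹ • (dilationF V + z • (1 : H →L[ℂ] H))) ?_ ?_)
    · convert isCompactOperator_zero using 1
      funext x
      have : ((1 - z * z)⁻¹ * (1 - z * z)) • x = x := by rw [inv_mul_cancel₀ hz2, one_smul]
      simp only [sub_apply, comp_apply, smul_apply, add_apply, clm_one_apply, map_sub, map_smul, hF',
        Pi.zero_apply]
      rw [sub_eq_zero]
      refine Eq.trans ?_ this
      module
    · convert isCompactOperator_zero using 1
      funext x
      have : ((1 - z * z)⁻¹ * (1 - z * z)) • x = x := by rw [inv_mul_cancel₀ hz2, one_smul]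
      simp only [sub_apply, comp_apply, smul_apply, add_apply, clm_one_apply, map_add, map_smul, hF',
        Pi.zero_apply]
      rw [sub_eq_zero]
      refine Eq.trans ?_ this
      module
  · rintro (rfl | rfl) hfr
    · have := hfr.finite_ker
      refine hK' (Submodule.finiteDimensional_of_le
        (S₂ := (dilationF V - (-1 : ℂ) • (1 : H →L[ℂ] H)).ker) ?_)
      intro x hx
      have h0 : adjoint V.toContinuousLinearMap x = 0 := by
        rw [orthogonal_range] at hx
        exact hx
      rw [LinearMap.mem_ker]
      change dilationF V x - (-1 : ℂ) • x = 0
      rw [dilationF_apply, h0, map_zero]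
      module
    · have := hfr.finite_ker
      refine hK (FiniteDimensional.of_injective
        ((V.toLinearMap).codRestrict (dilationF V - (1 : ℂ) • (1 : H →L[ℂ] H)).ker ?_) ?_)
      · intro y
        rw [LinearMap.mem_ker]
        change dilationF V (V y) - (1 : ℂ) • V y = 0
        rw [dilationF_map, one_smul, sub_self]
      · exact (LinearMap.injective_codRestrict_iff ..).2 V.injective

theorem isSFStarHat_of_compact {G : H →L[ℂ] H} (hK : ¬ FiniteDimensional ℂ K)
    (hK' : ¬ FiniteDimensional ℂ (V.toContinuousLinearMap.rangeᗮ : Submodule ℂ H))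
    (hG : IsSelfAdjoint G) (hn : ‖G‖ ≤ 1)
    (hc : IsCompactOperator (G - dilationF V : H →L[ℂ] H)) : IsSFStarHat G := by
  have he := essSpectrum_eq_of_compact V hK hK' hc
  have h0 : (0 : ℂ) ∉ essSpectrum G := by rw [he]; norm_num
  have h1 : (1 : ℂ) ∈ essSpectrum G := by rw [he]; simp
  refine
    { selfAdjoint := hG
      fredholm := by simpa [essSpectrum] using h0
      pos := ⟨1, one_pos, by rw [he]; simp⟩
      neg := ⟨-1, by norm_num, by rw [he]; simp⟩
      norm_eq := le_antisymm hn ?_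
      ess_eq := he }
  -- If the norm were below one, `1 - G` would be invertible, contradicting that `1` lies in the
  -- essential spectrum.
  by_contra hlt
  push Not at hlt
  refine h1 ?_
  obtain ⟨u, hu⟩ := (isUnit_one_sub_of_norm_lt_one hlt).neg
  have hu' : G - (1 : ℂ) • (1 : H →L[ℂ] H) = u := by rw [hu, one_smul, neg_sub]
  rw [hu']
  refine isFredholm_of_compact (S := (↑u⁻¹ : H →L[ℂ] H)) ?_ ?_
  · have : (↑u⁻¹ : H →L[ℂ] H) ∘L (u : H →L[ℂ] H) - 1 = 0 := sub_eq_zero.2 u.inv_mul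
    rw [this]; exact isCompactOperator_zero
  · have : (u : H →L[ℂ] H) ∘L (↑u⁻¹ : H →L[ℂ] H) - 1 = 0 := sub_eq_zero.2 u.mul_inv
    rw [this]; exact isCompactOperator_zero

end Dilation

/-! ### The straight line path -/

section Line

variable {H : Type*} [NormedAddCommGroup H] [InnerProductSpace ℂ H] [CompleteSpace H]

theorem adjoint_apply_self {U : H →L[ℂ] H} (hU : U ∈ unitary (H →L[ℂ] H)) (x : H) :
    adjoint U (U x) = x :=
  congrArg (fun A : H →L[ℂ] H => A x) hU.1

theorem apply_adjoint_self {U : H →L[ℂ] H} (hU : U ∈ unitary (H →L[ℂ] H)) (x : H) :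
    U (adjoint U x) = x :=
  congrArg (fun A : H →L[ℂ] H => A x) hU.2

theorem norm_unitary_apply {U : H →L[ℂ] H} (hU : U ∈ unitary (H →L[ℂ] H)) (x : H) :
    ‖U x‖ = ‖x‖ := by
  have h : inner ℂ (U x) (U x) = inner ℂ x x := by
    rw [← adjoint_inner_right, adjoint_apply_self hU]
  rw [inner_self_eq_norm_sq_to_K, inner_self_eq_norm_sq_to_K] at h
  have h2 : ‖U x‖ ^ 2 = ‖x‖ ^ 2 := by exact_mod_cast h
  exact (pow_left_inj₀ (norm_nonneg _) (norm_nonneg _) two_ne_zero).1 h2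

theorem linePath_apply (F : H →L[ℂ] H) {U : H →L[ℂ] H} (hU : U ∈ unitary (H →L[ℂ] H)) (s : ℝ)
    (x : H) : linePath F U s x = F x + (s : ℂ) • (adjoint U (F (U x)) - F x) := by
  simp only [linePath, add_apply, smul_apply, comp_apply, sub_apply, map_sub,
    adjoint_apply_self hU]

theorem linePath_eq (F : H →L[ℂ] H) {U : H →L[ℂ] H} (hU : U ∈ unitary (H →L[ℂ] H)) (s : ℝ) :
    linePath F U s = ((1 - s : ℝ) : ℂ) • F + (s : ℂ) • (adjoint U ∘L F ∘L U) := by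
  ext x
  rw [linePath_apply F hU]
  simp only [add_apply, smul_apply, comp_apply, Complex.ofReal_sub, Complex.ofReal_one]
  module

theorem isSelfAdjoint_linePath {F : H →L[ℂ] H} (hF : IsSelfAdjoint F) {U : H →L[ℂ] H}
    (hU : U ∈ unitary (H →L[ℂ] H)) (s : ℝ) : IsSelfAdjoint (linePath F U s) := by
  have h : IsSelfAdjoint (adjoint U ∘L F ∘L U) := by
    rw [isSelfAdjoint_iff', adjoint_comp, adjoint_comp, adjoint_adjoint, hF.adjoint_eq, comp_assoc]
  have hr : ∀ r : ℝ, IsSelfAdjoint (r : ℂ) := fun r => Complex.conj_ofReal r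
  rw [linePath_eq F hU]
  exact ((hr _).smul hF).add ((hr _).smul h)

theorem norm_linePath_le {F : H →L[ℂ] H} (hF : ‖F‖ ≤ 1) {U : H →L[ℂ] H}
    (hU : U ∈ unitary (H →L[ℂ] H)) {s : ℝ} (hs : s ∈ Icc (0 : ℝ) 1) : ‖linePath F U s‖ ≤ 1 := by
  have hU' : adjoint U ∈ unitary (H →L[ℂ] H) := Unitary.star_mem hU
  have hFx : ∀ y, ‖F y‖ ≤ ‖y‖ := fun y =>
    (F.le_opNorm y).trans (by nlinarith [norm_nonneg y])
  refine opNorm_le_bound _ zero_le_one fun x => ?_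
  rw [linePath_eq F hU]
  rw [add_apply]
  refine (norm_add_le _ _).trans ?_
  simp only [smul_apply, comp_apply, norm_smul, Complex.norm_real, norm_unitary_apply hU']
  rw [Real.norm_of_nonneg hs.1, Real.norm_of_nonneg (sub_nonneg.2 hs.2)]
  have h1 := mul_le_mul_of_nonneg_left (hFx x) (sub_nonneg.2 hs.2)
  have h2 := mul_le_mul_of_nonneg_left (hFx (U x)) hs.1
  rw [norm_unitary_apply hU] at h2
  linarith

theorem continuous_linePath (F U : H →L[ℂ] H) : Continuous (linePath F U) := by
  unfold linePath
  exact continuous_const.add (Complex.continuous_ofReal.smul continuous_const)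

theorem isCompactOperator_linePath_sub {F U : H →L[ℂ] H}
    (h : IsCompactOperator (F ∘L U - U ∘L F : H →L[ℂ] H)) (s : ℝ) :
    IsCompactOperator (linePath F U s - F : H →L[ℂ] H) := by
  rw [linePath, add_sub_cancel_left]
  exact isCompactOperator_smul (isCompactOperator_comp_left h (adjoint U)) _

theorem isOddStructure_apply {C : Conjugation H} {I : H →L[ℂ] H} (hI : IsOddStructure C I)
    (x : H) : I (I x) = -x :=
  congrArg (fun A : H →L[ℂ] H => A x) hI.sq

theorem isOddStructure_map {C : Conjugation H} {I : H →L[ℂ] H} (hI : IsOddStructure C I)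
    (x : H) : C.toEquiv (I x) = I (C.toEquiv x) := by
  have h := congrArg (fun A : H →L[ℂ] H => A (C.toEquiv x)) hI.real
  change C.toEquiv (I (C.toEquiv (C.toEquiv x))) = I (C.toEquiv x) at h
  rwa [C.involutive] at h

theorem conjOp_mem_unitary (C : Conjugation H) {U : H →L[ℂ] H} (hU : U ∈ unitary (H →L[ℂ] H)) :
    conjOp C U ∈ unitary (H →L[ℂ] H) := by
  rw [Unitary.mem_iff, star_eq_adjoint, adjoint_conjOp]
  constructor
  · ext x
    change conjOp C (adjoint U) (conjOp C U x) = x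
    rw [conjOp_apply, conjOp_apply, C.involutive, adjoint_apply_self hU, C.involutive]
  · ext x
    change conjOp C U (conjOp C (adjoint U) x) = x
    rw [conjOp_apply, conjOp_apply, C.involutive, apply_adjoint_self hU, C.involutive]

/-- For an odd symmetric `U` one has `Ū* I = I U`. -/
theorem adjoint_conjOp_apply {C : Conjugation H} {I U : H →L[ℂ] H} (hI : IsOddStructure C I)
    (hs : IsOddSymmetric C I U) (x : H) : adjoint (conjOp C U) (I x) = I (U x) := by
  have h : adjoint I (adjoint (conjOp C U) (I x)) = U x :=
    congrArg (fun A : H →L[ℂ] H => A x) hs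
  rw [← h, apply_adjoint_self hI.unitary]

/-- The antiunitary operator `C I U` has square `-1`. -/
theorem antiunitary_sq {C : Conjugation H} {I U : H →L[ℂ] H} (hI : IsOddStructure C I)
    (hU : U ∈ unitary (H →L[ℂ] H)) (hs : IsOddSymmetric C I U) (x : H) :
    C.toEquiv ((I ∘L U) (C.toEquiv ((I ∘L U) x))) = -x := by
  have h1 : conjOp C U (I (U x)) = I x := by
    rw [← adjoint_conjOp_apply hI hs, apply_adjoint_self (conjOp_mem_unitary C hU)]
  rw [comp_apply, comp_apply, isOddStructure_map hI]
  rw [conjOp_apply] at h1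
  rw [h1, isOddStructure_apply hI]

/-- The line joins `F` to `U*FU`, and transposition followed by conjugation with `IU` exchanges
these ends. Indeed `F` is real and commutes with `I`, while the transpose of `U*FU` is `Ū*FŪ`, and
`Ū I U = I` by odd symmetry. -/
theorem linePath_symm {C : Conjugation H} {I F U : H →L[ℂ] H} (hI : IsOddStructure C I)
    (hU : U ∈ unitary (H →L[ℂ] H)) (hs : IsOddSymmetric C I U) (hF : IsSelfAdjoint F)
    (hreal : conjOp C F = F) (hcomm : ∀ x, F (I x) = I (F x)) (s : ℝ) :
    linePath F U (1 - s) =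
      adjoint (I ∘L U) ∘L transposeOp C (linePath F U s) ∘L (I ∘L U) := by
  have hr : ∀ (r : ℝ) y, C.toEquiv ((r : ℂ) • y) = (r : ℂ) • C.toEquiv y := fun r y => by
    have := C.toEquiv.map_smulₛₗ (r : ℂ) y
    rwa [Complex.conj_ofReal] at this
  have hF' : ∀ x, C.toEquiv (F x) = F (C.toEquiv x) := fun x => by
    have h := congrArg (fun A : H →L[ℂ] H => A (C.toEquiv x)) hreal
    change C.toEquiv (F (C.toEquiv (C.toEquiv x))) = F (C.toEquiv x) at h
    rwa [C.involutive] at h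
  have ht : ∀ y, transposeOp C (linePath F U s) y =
      F y + (s : ℂ) • (adjoint (conjOp C U) (F (conjOp C U y)) - F y) := by
    intro y
    rw [transposeOp, adjoint_conjOp, (isSelfAdjoint_linePath hF hU s).adjoint_eq, conjOp_apply,
      linePath_apply F hU, map_add, hr, map_sub, hF', C.involutive, adjoint_conjOp, conjOp_apply,
      conjOp_apply, hF', C.involutive]
  have hUU := conjOp_mem_unitary C hU
  ext x
  rw [linePath_apply F hU]
  simp only [comp_apply]
  rw [ht, ← adjoint_conjOp_apply hI hs x, apply_adjoint_self hUU, adjoint_conjOp_apply hI hs,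
    hcomm, hcomm, adjoint_conjOp_apply hI hs, adjoint_comp, comp_apply, map_add, map_smul, map_sub,
    adjoint_apply_self hI.unitary, adjoint_apply_self hI.unitary, map_add, map_smul, map_sub,
    adjoint_apply_self hU]
  push_cast
  module

end Line

/-! ### Dilations: symmetry, commutator and the midpoint of the line -/

section Dilation

variable {K H : Type*} [NormedAddCommGroup K] [InnerProductSpace ℂ K] [CompleteSpace K]
  [NormedAddCommGroup H] [InnerProductSpace ℂ H] [CompleteSpace H] (V : K →ₗᵢ[ℂ] H)

theorem conjOp_dilationF {CK : Conjugation K} {CH : Conjugation H}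
    (hV : ∀ x, CH.toEquiv (V x) = V (CK.toEquiv x)) :
    conjOp CH (dilationF V) = dilationF V := by
  have hadj : ∀ x, adjoint V.toContinuousLinearMap (CH.toEquiv x) =
      CK.toEquiv (adjoint V.toContinuousLinearMap x) := by
    intro x
    refine ext_inner_left ℂ fun y => ?_
    rw [adjoint_inner_right, LinearIsometry.coe_toContinuousLinearMap, ← CK.involutive y, ← hV,
      CH.inner_map_map, CK.inner_map_map, adjoint_inner_left]
    rfl
  have h2 : ∀ y, CH.toEquiv ((2 : ℂ) • y) = (2 : ℂ) • CH.toEquiv y := fun y => by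
    rw [two_smul, two_smul, map_add]
  ext x
  rw [conjOp_apply, dilationF_apply, map_sub, h2, hV, hadj, CK.involutive, CH.involutive,
    dilationF_apply]

/-- Since `I_K = Π*I_HΠ` is isometric, `Π*` loses no norm on `I_HΠy`, which must then lie in the
range of `Π`; so `I_HΠ = ΠI_K`. As `I* = -I` on both sides, adjoints give `Π*I_H = I_KΠ*`. -/
theorem dilationF_comm {CK : Conjugation K} {CH : Conjugation H} {IK : K →L[ℂ] K}
    {IH : H →L[ℂ] H} (hIK : IsOddStructure CK IK) (hIH : IsOddStructure CH IH)
    (hVI : IK = adjoint V.toContinuousLinearMap ∘L IH ∘L V.toContinuousLinearMap) (x : H) :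
    dilationF V (IH x) = IH (dilationF V x) := by
  set P := V.toContinuousLinearMap with hP
  have hIKy : ∀ y, IK y = adjoint P (IH (V y)) := fun y =>
    congrArg (fun A : K →L[ℂ] K => A y) hVI
  have hmap : ∀ y, IH (V y) = V (IK y) := by
    intro y
    have h1 : dilationF V (IH (V y)) = (2 : ℂ) • V (IK y) - IH (V y) := by
      rw [dilationF_apply, hIKy]
    have h2 := re_inner_dilationF V (IH (V y))
    rw [← hIKy, norm_unitary_apply hIK.unitary, norm_unitary_apply hIH.unitary, V.norm_map] at h2
    have h3 : ‖IH (V y) - V (IK y)‖ ^ 2 = 0 := by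
      rw [@norm_sub_sq ℂ, norm_unitary_apply hIH.unitary, V.norm_map, V.norm_map,
        norm_unitary_apply hIK.unitary]
      rw [h1, inner_sub_right, inner_smul_right, inner_self_eq_norm_sq_to_K,
        norm_unitary_apply hIH.unitary, V.norm_map] at h2
      have h4 : (((‖y‖ : ℝ) : ℂ) ^ 2).re = ‖y‖ ^ 2 := by norm_cast
      have h5 : (2 * inner ℂ (IH (V y)) (V (IK y))).re = 2 * (inner ℂ (IH (V y)) (V (IK y))).re := by
        simp
      rw [Complex.sub_re, h5] at h2
      erw [h4] at h2
      rw [RCLike.re_to_complex]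
      linarith
    exact sub_eq_zero.1 (norm_eq_zero.1 (pow_eq_zero_iff two_ne_zero |>.1 h3))
  have hadjI : adjoint IH = -IH := by
    ext z
    have := adjoint_apply_self hIH.unitary (-(IH z))
    rw [map_neg, isOddStructure_apply hIH, neg_neg] at this
    exact this
  have hadjK : adjoint IK = -IK := by
    ext z
    have := adjoint_apply_self hIK.unitary (-(IK z))
    rw [map_neg, isOddStructure_apply hIK, neg_neg] at this
    exact this
  have hPI : ∀ z, adjoint P (IH z) = IK (adjoint P z) := by
    intro z
    refine ext_inner_left ℂ fun y => ?_
    have e1 : inner ℂ y (adjoint P (IH z)) = inner ℂ (adjoint IH (V y)) z := by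
      rw [adjoint_inner_right, adjoint_inner_left]; rfl
    have e2 : inner ℂ y (IK (adjoint P z)) = inner ℂ (V (adjoint IK y)) z := by
      rw [← adjoint_inner_left, adjoint_inner_right]; rfl
    rw [e1, e2, hadjI, hadjK, neg_apply, neg_apply, hmap, map_neg]
  rw [dilationF_apply, dilationF_apply, hPI, ← hmap, map_sub, map_smul]

theorem isOddSymmetric_of_comm {C : Conjugation H} {I F : H →L[ℂ] H} (hI : IsOddStructure C I)
    (hF : IsSelfAdjoint F) (hreal : conjOp C F = F) (hcomm : ∀ x, F (I x) = I (F x)) :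
    IsOddSymmetric C I F := by
  ext x
  rw [transposeOp, hreal, hF.adjoint_eq]
  simp only [comp_apply]
  rw [hcomm, adjoint_apply_self hI.unitary]

/-- The commutator of `F` with a unitary dilation of an essentially unitary operator. -/
theorem commutator_compact {T : K →L[ℂ] K} (hT : IsEssentiallyUnitary T) {U : H →L[ℂ] H}
    (hU : U ∈ unitary (H →L[ℂ] H))
    (hdil : T = adjoint V.toContinuousLinearMap ∘L U ∘L V.toContinuousLinearMap) :
    IsCompactOperator (dilationF V ∘L U - U ∘L dilationF V : H →L[ℂ] H) := by
  set P := V.toContinuousLinearMap with hP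
  have hPP : ∀ y, adjoint P (P y) = y := adjoint_isometry_apply V
  -- For the off-diagonal block `A = (1 - ΠΠ*)WΠ` of a unitary dilation `W` of `S`, `A*A = 1 - S*S`.
  -- Applied to `U` and `U*` this makes both off-diagonal blocks of `U` compact, and the commutator
  -- is built from them.
  have key : ∀ (S : K →L[ℂ] K) (W : H →L[ℂ] H), W ∈ unitary (H →L[ℂ] H) →
      S = adjoint P ∘L W ∘L P → IsCompactOperator (adjoint S ∘L S - 1 : K →L[ℂ] K) →
      IsCompactOperator ((1 - P ∘L adjoint P) ∘L W ∘L P : K →L[ℂ] H) := by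
    intro S W hW hS hc
    refine isCompactOperator_of_adjoint_comp ?_
    have e : adjoint ((1 - P ∘L adjoint P) ∘L W ∘L P) ∘L ((1 - P ∘L adjoint P) ∘L W ∘L P) =
        1 - adjoint S ∘L S := by
      have h1 : adjoint (1 : H →L[ℂ] H) = 1 := (IsSelfAdjoint.one (H →L[ℂ] H)).adjoint_eq
      rw [hS]
      simp only [adjoint_comp, adjoint_adjoint, map_sub, h1]
      ext y
      simp only [comp_apply, sub_apply, clm_one_apply, map_sub, hPP, adjoint_apply_self hW]
      abel
    rw [e]
    exact isCompactOperator_sub_comm hc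
  have c1 := key T U hU hdil hT.compact_left
  have c2 := key (adjoint T) (adjoint U) (Unitary.star_mem hU)
    (by rw [hdil]; simp only [adjoint_comp, adjoint_adjoint, comp_assoc])
    (by rw [adjoint_adjoint]; exact hT.compact_right)
  have c2' := isCompactOperator_adjoint c2
  have e : dilationF V ∘L U - U ∘L dilationF V =
      (2 : ℂ) • (P ∘L adjoint ((1 - P ∘L adjoint P) ∘L adjoint U ∘L P)) +
      (-2 : ℂ) • (((1 - P ∘L adjoint P) ∘L U ∘L P) ∘L adjoint P) := by
    have h1 : adjoint (1 : H →L[ℂ] H) = 1 := (IsSelfAdjoint.one (H →L[ℂ] H)).adjoint_eq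
    simp only [adjoint_comp, adjoint_adjoint, map_sub, h1]
    ext x
    have hd : ∀ x, dilationF V x = (2 : ℂ) • P (adjoint P x) - x := dilationF_apply V
    simp only [comp_apply, sub_apply, add_apply, smul_apply, clm_one_apply, map_sub, hd, map_smul]
    module
  rw [e]
  exact isCompactOperator_add
    (isCompactOperator_smul (isCompactOperator_comp_left c2' P) _)
    (isCompactOperator_smul (isCompactOperator_comp_right c1 (adjoint P)) _)

/-- The half-path spectral flow of the straight line path is minus the dimension of `ker T`. -/
theorem relIndex_linePath {T : K →L[ℂ] K} {U : H →L[ℂ] H} (hU : U ∈ unitary (H →L[ℂ] H))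
    (hdil : T = adjoint V.toContinuousLinearMap ∘L U ∘L V.toContinuousLinearMap) :
    relIndex (specSub (dilationF V) 0) (specSub (linePath (dilationF V) U (1 / 2)) 0) =
      -(finrank ℂ T.ker : ℤ) := by
  set F := dilationF V with hFdef
  set G := linePath F U (1 / 2) with hGdef
  have hF : IsSelfAdjoint F := isSelfAdjoint_dilationF V
  have hFF : F ∘L F = 1 := dilationF_comp_self V
  have hG : IsSelfAdjoint G := isSelfAdjoint_linePath hF hU _
  have hGx : ∀ x, G x = ((1 / 2 : ℝ) : ℂ) • (F x + adjoint U (F (U x))) := fun x => by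
    rw [hGdef, linePath_apply F hU]
    push_cast
    module
  have hq : ∀ x, (inner ℂ x (G x)).re =
      1 / 2 * ((inner ℂ x (F x)).re + (inner ℂ (U x) (F (U x))).re) := fun x => by
    rw [hGx, inner_smul_right, inner_add_right, adjoint_inner_right, Complex.re_ofReal_mul,
      Complex.add_re]
  have hTy : ∀ y, T y = adjoint V.toContinuousLinearMap (U (V y)) := fun y =>
    congrArg (fun A : K →L[ℂ] K => A y) hdil
  have hFle : ∀ x, (inner ℂ x (F x)).re ≤ ‖x‖ ^ 2 := fun x => by
    have h1 := Complex.re_le_norm (inner ℂ x (F x))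
    have h2 := norm_inner_le_norm (𝕜 := ℂ) x (F x)
    have h3 := F.le_opNorm x
    have h4 := norm_dilationF_le V
    nlinarith [norm_nonneg x, mul_le_mul_of_nonneg_right h4 (norm_nonneg x)]
  -- Where `Fx = -x` the form of `G` is at most `(-‖x‖² + ‖Ux‖²)/2 = 0`, whereas it is positive on
  -- nonzero vectors of the complement.
  have e1 : specSub F 0 ⊓ (specSub G 0)ᗮ = ⊥ := by
    rw [Submodule.eq_bot_iff]
    rintro x ⟨hx1, hx2⟩
    refine eq_zero_of_mem_orthogonal hG hx2 ?_
    rw [SetLike.mem_coe, mem_specSub_symmetry hF hFF] at hx1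
    have h1 := hFle (U x)
    rw [norm_unitary_apply hU] at h1
    have h2 : (inner ℂ x (F x)).re = -‖x‖ ^ 2 := by
      have := inner_self_eq_norm_sq (𝕜 := ℂ) x
      rw [RCLike.re_to_complex] at this
      rw [hx1, inner_neg_right, Complex.neg_re, this]
    rw [hq]
    linarith
  -- Where `Fx = x`, a nonpositive form of `G` forces `⟨Ux, FUx⟩ ≤ -‖Ux‖²`, so `Π*Ux = 0`, which is
  -- `Tx' = 0` for `x = Πx'`. Conversely `Π` maps `Ker T` into `Ker G`.
  have e2 : specSub G 0 ⊓ (specSub F 0)ᗮ = (T.ker).map V.toLinearMap := by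
    ext x
    simp only [Submodule.mem_inf, mem_specSub_orthogonal_symmetry hF hFF, Submodule.mem_map]
    constructor
    · rintro ⟨hx1, hx2⟩
      have hxV : V (adjoint V.toContinuousLinearMap x) = x := by
        rw [hFdef, dilationF_apply, sub_eq_iff_eq_add, ← two_smul ℂ x] at hx2
        exact smul_right_injective H (two_ne_zero (α := ℂ)) hx2
      refine ⟨adjoint V.toContinuousLinearMap x, ?_, hxV⟩
      have h1 := re_inner_nonpos_of_mem hG hx1
      have h2 : (inner ℂ x (F x)).re = ‖x‖ ^ 2 := by
        have := inner_self_eq_norm_sq (𝕜 := ℂ) x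
        rw [RCLike.re_to_complex] at this
        rw [hx2, this]
      rw [hq, h2, hFdef, re_inner_dilationF, norm_unitary_apply hU] at h1
      have h3 : ‖adjoint V.toContinuousLinearMap (U x)‖ ^ 2 = 0 :=
        le_antisymm (by linarith) (sq_nonneg _)
      change T _ = 0
      rw [hTy, hxV]
      exact norm_eq_zero.1 (pow_eq_zero_iff two_ne_zero |>.1 h3)
    · rintro ⟨y, hy, rfl⟩
      change T y = 0 at hy
      change V y ∈ _ ∧ F (V y) = V y
      have h1 : F (V y) = V y := dilationF_map V y
      refine ⟨mem_specSub_zero_of_apply_eq hG (l := 0) le_rfl ?_, h1⟩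
      have h2 : F (U (V y)) = -U (V y) := by
        rw [hFdef, dilationF_apply, ← hTy, hy, map_zero, smul_zero, zero_sub]
      rw [hGx, h1, h2, map_neg, adjoint_apply_self hU, add_neg_cancel, smul_zero, zero_smul]
  rw [relIndex, e1, e2, finrank_bot,
    ← (Submodule.equivMapOfInjective V.toLinearMap V.injective T.ker).finrank_eq]
  simp

end Dilation

end OddFlow

end

/-! ### Assembly: parity is independent of the path -/

theorem mainTheorem1 {K : Type*} {H : Type*}
    [NormedAddCommGroup K] [InnerProductSpace ℂ K] [CompleteSpace K]
    [NormedAddCommGroup H] [InnerProductSpace ℂ H] [CompleteSpace H]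
    (CK : OddFlow.Conjugation K) (CH : OddFlow.Conjugation H)
    (IK : K →L[ℂ] K) (hIK : OddFlow.IsOddStructure CK IK)
    (IH : H →L[ℂ] H) (hIH : OddFlow.IsOddStructure CH IH)
    (V : K →ₗᵢ[ℂ] H)
    (hVreal : ∀ x, CH.toEquiv (V x) = V (CK.toEquiv x))
    (hVI : IK = ContinuousLinearMap.adjoint V.toContinuousLinearMap ∘L IH ∘L
      V.toContinuousLinearMap)
    (hK : ¬ FiniteDimensional ℂ K)
    (hK' : ¬ FiniteDimensional ℂ (V.toContinuousLinearMap.rangeᗮ : Submodule ℂ H))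
    (T : K →L[ℂ] K) (hTsymm : OddFlow.IsOddSymmetric CK IK T)
    (hTess : OddFlow.IsEssentiallyUnitary T) (hTnorm : ‖T‖ ≤ 1)
    (U : H →L[ℂ] H) (hU : U ∈ unitary (H →L[ℂ] H))
    (hUsymm : OddFlow.IsOddSymmetric CH IH U)
    (hdil : T = ContinuousLinearMap.adjoint V.toContinuousLinearMap ∘L U ∘L
      V.toContinuousLinearMap) :
    ContinuousLinearMap.IsFredholm T ∧
    OddFlow.IsSFStarHat (OddFlow.dilationF V) ∧
    OddFlow.IsOddSymmetric CH IH (OddFlow.dilationF V) ∧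
    OddFlow.HasZ2SpectralFlow CH IH (OddFlow.dilationF V) U (OddFlow.index2 T) ∧
    OddFlow.IsThetaPath CH IH (OddFlow.dilationF V) U
      (OddFlow.linePath (OddFlow.dilationF V) U) ∧
    OddFlow.HasHalfFlowMod2 (OddFlow.linePath (OddFlow.dilationF V) U) (OddFlow.index2 T) := by
  have hF := OddFlow.isSelfAdjoint_dilationF V
  have hFF := OddFlow.dilationF_comp_self V
  have hFn := OddFlow.norm_dilationF_le V
  have hFreal := OddFlow.conjOp_dilationF V hVreal
  have hFI := OddFlow.dilationF_comm V hIK hIH hVI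
  have hcomm := OddFlow.commutator_compact V hTess hU hdil
  have hline : OddFlow.IsThetaPath CH IH (OddFlow.dilationF V) U
      (OddFlow.linePath (OddFlow.dilationF V) U) :=
    { cont := (OddFlow.continuous_linePath _ _).continuousOn
      mem := fun s hs => OddFlow.isSFStarHat_of_compact V hK hK'
        (OddFlow.isSelfAdjoint_linePath hF hU s) (OddFlow.norm_linePath_le hFn hU hs)
        (OddFlow.isCompactOperator_linePath_sub hcomm s)
      start := by
        ext x
        rw [OddFlow.linePath_apply _ hU, Complex.ofReal_zero, zero_smul, add_zero]
      compact := fun s _ => OddFlow.isCompactOperator_linePath_sub hcomm s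
      symm := fun s _ => OddFlow.linePath_symm hIH hU hUsymm hF hFreal hFI s }
  have hflow : ∀ γ, OddFlow.IsThetaPath CH IH (OddFlow.dilationF V) U γ →
      OddFlow.HasHalfFlowMod2 γ (OddFlow.index2 T) := by
    intro γ hγ
    have hsub : Set.Icc (0 : ℝ) (1 / 2) ⊆ Set.Icc 0 1 := Set.Icc_subset_Icc le_rfl (by norm_num)
    have hhalf : (1 / 2 : ℝ) ∈ Set.Icc (0 : ℝ) 1 := by constructor <;> norm_num
    have h0 : (0 : ℝ) ∈ Set.Ioo (-1 : ℝ) 1 := by norm_num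
    refine ⟨_, OddFlow.hasSpectralFlow_relIndex hFF (by norm_num) (hγ.cont.mono hsub)
      (fun t ht => (hγ.mem t (hsub ht)).toIsSFStar) (fun t ht => hγ.compact t (hsub ht)), ?_⟩
    have hJ : IH ∘L U ∈ unitary (H →L[ℂ] H) := mul_mem hIH.unitary hU
    -- The midpoint is the fixed point of the reflection `s ↦ 1 - s`, so there the path symmetry
    -- becomes commutation with the antiunitary `C I U`.
    have hinv : ∀ γ', OddFlow.IsThetaPath CH IH (OddFlow.dilationF V) U γ' →
        ∀ x ∈ OddFlow.specSub (γ' (1 / 2)) 0,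
          CH.toEquiv ((IH ∘L U) x) ∈ OddFlow.specSub (γ' (1 / 2)) 0 := by
      intro γ' hγ' x hx
      have hsa := (hγ'.mem _ hhalf).selfAdjoint
      have hs := hγ'.symm _ hhalf
      rw [OddFlow.transposeOp, OddFlow.adjoint_conjOp, hsa.adjoint_eq,
        show (1 - 1 / 2 : ℝ) = 1 / 2 by norm_num] at hs
      exact OddFlow.antiunitary_mem_specSub hJ hsa hs.symm hx
    have heven := OddFlow.even_relIndex hJ
      (OddFlow.antiunitary_sq hIH hU hUsymm) (hinv _ hline) (hinv _ hγ)
    have hc0 : IsCompactOperator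
        (OddFlow.dilationF V - OddFlow.dilationF V : H →L[ℂ] H) := by
      rw [sub_self]; exact isCompactOperator_zero
    have hadd := OddFlow.relIndex_add
      (OddFlow.specSub_sub_compact hFF hF hc0 (hline.mem _ hhalf).selfAdjoint
        (hline.compact _ hhalf) h0 h0)
      (OddFlow.specSub_sub_compact hFF (hline.mem _ hhalf).selfAdjoint
        (hline.compact _ hhalf) (hγ.mem _ hhalf).selfAdjoint (hγ.compact _ hhalf) h0 h0)
    -- The flow of `γ` is that of the line plus an even correction between the two midpoints.
    rw [hγ.start, ← hadd, OddFlow.relIndex_linePath V hU hdil]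
    rw [Int.cast_add, (ZMod.intCast_eq_zero_iff_even).2 heven, add_zero, Int.cast_neg,
      ZMod.neg_eq_self_mod_two, Int.cast_natCast]
    rfl
  refine ⟨OddFlow.isFredholm_of_compact hTess.compact_left hTess.compact_right,
    OddFlow.isSFStarHat_of_compact V hK hK' hF hFn ?_,
    OddFlow.isOddSymmetric_of_comm hIH hF hFreal hFI, ⟨⟨_, hline⟩, hflow⟩, hline,
    hflow _ hline⟩
  rw [sub_self]; exact isCompactOperator_zero
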